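/- **Theorem (addition theorems for the complex vector spherical harmonics).** Let $Y_l^m$ ($l\ge 0$, $|m|\le l$) be the complex orthonormal spherical harmonics on the unit sphere of $\mathbb R^3$ with the Condon–Shortley phase, i.e. for $0\le m\le l$ $$Y_l^m(\theta,\phi)=\sqrt{\frac{2l+1}{4\pi}\frac{(l-m)!}{(l+m)!}}\,(-1)^m\sin^m\theta\;P_l^{(m)}(\cos\theta)\,e^{im\phi},\qquad Y_l^{-m}=(-1)^m\overline{Y_l^m},$$ where $P_l^{(m)}$ is the $m$-th derivative of the Legendre polynomial $P_l$, and $Y_l^m=0$ for $|m|>l$. With the surface gradient $\nabla_S=\hat\theta\,\partial_\theta+\hat\phi\,\frac{1}{\sin\theta}\partial_\phi$ (extended to the poles as the intrinsic gradient on the sphere) put, for a unit vector $\hat{\mathbf r}$, $$V_l^m=\nabla_SY_l^m-(l+1)Y_l^m\hat{\mathbf r},\qquad W_l^m=\nabla_SY_l^m+l\,Y_l^m\hat{\mathbf r},\qquad X_l^m=\hat{\mathbf r}\times\nabla_SY_l^m ,$$ and define the regular and irregular solid harmonics $$R_l^m(\mathbf r)=\sqrt{\tfrac{4\pi}{2l+1}}\,|\mathbf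 r|^l\,Y_l^m(\hat{\mathbf r}),\qquad I_l^m(\mathbf r)=\sqrt{\tfrac{4\pi}{2l+1}}\,\frac{Y_l^m(\hat{\mathbf r})}{|\mathbf r|^{l+1}},\qquad \hat{\mathbf r}=\mathbf r/|\mathbf r|.$$ Let $l\ge 0$ and $m$ be integers with $|m|\le l$, let $\mathbf r,\mathbf a\in\mathbb R^3$ with $\mathbf r\ne 0$ and $|\mathbf a|>|\mathbf r|$, and write $\mathbf r'=\mathbf r+\mathbf a$, $r=|\mathbf r|$, $r'=|\mathbf r'|$, and $\hat{\mathbf r}'=\mathbf r'/r'$. Then $${r'}^{-l-2}V_l^m(\hat{\mathbf r}')=\sum_{\lambda=1}^\infty\sum_{\mu=-\lambda}^{\lambda}(-1)^{\lambda+\mu}\sqrt{\tfrac{2l+1}{2\lambda+1}}\;r^{\lambda-1}I_{l+\lambda}^{m-\mu}(\mathbf a)\sqrt{\binom{l+\lambda+\mu-m}{\lambda+\mu}\binom{l+\lambda+m-\mu}{\lambda-\mu}}\;W_\lambda^\mu(\hat{\mathbf r}),$$ $${r'}^{l-1}W_l^m(\hat{\mathbf r}')=\sum_{\lambda=0}^{l}\sum_{\mu=-\lambda}^{\lambda}\sqrt{\tfrac{2l+1}{2\lambda+1}}\;r^{\lambda-1}R_{l-\lambda}^{m-\mu}(\mathbf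 a)\sqrt{\binom{l+m}{\lambda+\mu}\binom{l-m}{\lambda-\mu}}\;W_\lambda^\mu(\hat{\mathbf r}),$$ $${r'}^{-l-1}X_l^m(\hat{\mathbf r}')=\sum_{\lambda=1}^\infty\sum_{\mu=-\lambda}^{\lambda}(-1)^{\lambda+\mu}\sqrt{\tfrac{2l+1}{2\lambda+1}}\;r^{\lambda-1}I_{l+\lambda}^{m-\mu}(\mathbf a)\sqrt{\binom{l+\lambda+\mu-m}{\lambda+\mu}\binom{l+\lambda+m-\mu}{\lambda-\mu}}\,\Bigl[r\,X_\lambda^\mu(\hat{\mathbf r})+\mathbf a\times W_\lambda^\mu(\hat{\mathbf r})\Bigr],$$ where the two series over $\lambda$ (of the finite inner sums over $\mu$) converge unconditionally in $\mathbb C^3$, and binomial coefficients $\binom nk$ with $k>n\ge0$ are $0$. -/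

import Mathlib

/-! Complex vector spherical harmonics on `ℝ³` and complex solid harmonics.
Points of `ℝ³` live in `EuclideanSpace ℝ (Fin 3)` (so that `‖r‖` is the Euclidean length), complex
vector fields take values in `Fin 3 → ℂ`, where `⨯₃` is the (bilinear) cross product. -/

open scoped Matrix

namespace VectorHarmonics

noncomputable section

abbrev E3 : Type := EuclideanSpace ℝ (Fin 3)

/-- The unit vector `r̂ = r / |r|` (meaningful for `r ≠ 0`). -/
def unitVec (r : E3) : E3 := ‖r‖⁻¹ • r

/-- A real vector regarded as a complex vector. -/
def toC3 (a : E3) : Fin 3 → ℂ := fun i => (a i : ℂ)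

/-- The Legendre polynomial, by Rodrigues' formula
`P_l(z) = 1 / (2 ^ l l!) * (d / dz) ^ l (z ^ 2 - 1) ^ l`. -/
def legendreP (l : ℕ) : Polynomial ℝ :=
  Polynomial.C ((2 : ℝ) ^ l * (l.factorial : ℝ))⁻¹ *
    Polynomial.derivative^[l] ((Polynomial.X ^ 2 - 1) ^ l)

/-- The complex spherical harmonic `Y_l^m` for an order `m ≥ 0`, with the Condon–Shortley phase,
in Cartesian form: at a unit vector `(x, y, z)` with polar angles `θ`, `φ` one has
`z = cos θ` and `x + i y = sin θ exp (i φ)`; see `sphericalYNonneg_polar`. -/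
def sphericalYNonneg (l m : ℕ) (w : E3) : ℂ :=
  (-1 : ℂ) ^ m *
    ((Real.sqrt ((2 * (l : ℝ) + 1) / (4 * Real.pi) *
        (((l - m).factorial : ℝ) / ((l + m).factorial : ℝ))) : ℝ) : ℂ) *
    (((Polynomial.derivative^[m] (legendreP l)).eval (w 2) : ℝ) : ℂ) *
    ((w 0 : ℂ) + (w 1 : ℂ) * Complex.I) ^ m

/-- The complex spherical harmonic `Y_l^m` at a unit vector, for every integer order `m`;
`Y_l^{-m} = (-1) ^ m * conj (Y_l^m)`, and `Y_l^m = 0` for `|m| > l`. -/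
def sphericalY (l : ℕ) (m : ℤ) (w : E3) : ℂ :=
  if 0 ≤ m then sphericalYNonneg l m.toNat w
  else (-1 : ℂ) ^ m.natAbs * (starRingEnd ℂ) (sphericalYNonneg l m.natAbs w)

/-- The surface gradient `∇_S f` on the unit sphere at the unit vector `w`: the gradient at `w` of
the extension `x ↦ f (x / |x|)` of `f`, which is constant along rays. Away from the poles it is
`θ̂ ∂f/∂θ + φ̂ (1 / sin θ) ∂f/∂φ`; see `surfaceGradient_polar`. -/
def surfaceGradient (f : E3 → ℂ) (w : E3) : Fin 3 → ℂ :=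
  fun i => fderiv ℝ (fun x : E3 => f (unitVec x)) w (EuclideanSpace.single i 1)

/-- `V_l^m(w) = ∇_S Y_l^m(w) - (l + 1) Y_l^m(w) w`. -/
def vectorV (l : ℕ) (m : ℤ) (w : E3) : Fin 3 → ℂ :=
  surfaceGradient (sphericalY l m) w - (((l : ℂ) + 1) * sphericalY l m w) • toC3 w

/-- `W_l^m(w) = ∇_S Y_l^m(w) + l Y_l^m(w) w`. -/
def vectorW (l : ℕ) (m : ℤ) (w : E3) : Fin 3 → ℂ :=
  surfaceGradient (sphericalY l m) w + ((l : ℂ) * sphericalY l m w) • toC3 w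

/-- `X_l^m(w) = w × ∇_S Y_l^m(w)`. -/
def vectorX (l : ℕ) (m : ℤ) (w : E3) : Fin 3 → ℂ :=
  toC3 w ⨯₃ surfaceGradient (sphericalY l m) w

/-- The regular solid harmonic `R_l^m`. -/
def solidR (l : ℕ) (m : ℤ) (r : E3) : ℂ :=
  ((Real.sqrt (4 * Real.pi / (2 * (l : ℝ) + 1)) : ℝ) : ℂ) * ((‖r‖ ^ l : ℝ) : ℂ) *
    sphericalY l m (unitVec r)

/-- The irregular solid harmonic `I_l^m` (meaningful for `r ≠ 0`). -/
def solidI (l : ℕ) (m : ℤ) (r : E3) : ℂ :=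
  ((Real.sqrt (4 * Real.pi / (2 * (l : ℝ) + 1)) : ℝ) : ℂ) *
    (sphericalY l m (unitVec r) / ((‖r‖ ^ (l + 1) : ℝ) : ℂ))

/-- The binomial coefficient of nonnegative integers given as elements of `ℤ`. -/
def binom (n k : ℤ) : ℝ := (n.toNat.choose k.toNat : ℝ)

/-! Polar coordinates: the two facts that tie the Cartesian definitions to the usual ones. -/

/-- The unit vector with polar angle `θ` and azimuth `φ`. -/
def polar (θ φ : ℝ) : E3 :=
  !₂[Real.sin θ * Real.cos φ, Real.sin θ * Real.sin φ, Real.cos θ]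

theorem sphericalYNonneg_polar (l m : ℕ) (θ φ : ℝ) :
    sphericalYNonneg l m (polar θ φ) =
      ((Real.sqrt ((2 * (l : ℝ) + 1) / (4 * Real.pi) *
          (((l - m).factorial : ℝ) / ((l + m).factorial : ℝ))) : ℝ) : ℂ) *
      (((-1) ^ m * Real.sin θ ^ m *
          (Polynomial.derivative^[m] (legendreP l)).eval (Real.cos θ) : ℝ) : ℂ) *
      Complex.exp (Complex.I * m * φ) := by
  have h : Complex.exp (Complex.I * m * φ) = (Complex.cos φ + Complex.sin φ * Complex.I) ^ m := by
    rw [← Complex.exp_mul_I, ← Complex.exp_nat_mul]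
    congr 1
    ring
  have h2 : ((Real.sin θ * Real.cos φ : ℝ) : ℂ) + ((Real.sin θ * Real.sin φ : ℝ) : ℂ) * Complex.I
      = (Real.sin θ : ℂ) * (Complex.cos φ + Complex.sin φ * Complex.I) := by
    push_cast
    ring
  have h0 : (polar θ φ) 0 = Real.sin θ * Real.cos φ := rfl
  have h1 : (polar θ φ) 1 = Real.sin θ * Real.sin φ := rfl
  have h3 : (polar θ φ) 2 = Real.cos θ := rfl
  rw [sphericalYNonneg, h0, h1, h3, h2, h, mul_pow]
  push_cast
  ring

theorem norm_polar (θ φ : ℝ) : ‖polar θ φ‖ = 1 := by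
  rw [EuclideanSpace.norm_eq, Real.sqrt_eq_one]
  simp only [polar, Fin.sum_univ_three, Real.norm_eq_abs, sq_abs]
  simp only [Matrix.cons_val]
  nlinarith [Real.sin_sq_add_cos_sq θ, Real.sin_sq_add_cos_sq φ]

theorem surfaceGradient_polar (f : E3 → ℂ) (θ φ : ℝ) (hθ : Real.sin θ ≠ 0)
    (hf : DifferentiableAt ℝ (fun x : E3 => f (unitVec x)) (polar θ φ)) :
    surfaceGradient f (polar θ φ) =
      deriv (fun t : ℝ => f (polar t φ)) θ •
          toC3 !₂[Real.cos θ * Real.cos φ, Real.cos θ * Real.sin φ, -Real.sin θ] +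
        (((1 / Real.sin θ : ℝ) : ℂ) * deriv (fun t : ℝ => f (polar θ t)) φ) •
          toC3 !₂[-Real.sin φ, Real.cos φ, 0] := by
  have hu : ∀ s t, unitVec (polar s t) = polar s t := fun s t => by
    simp [unitVec, norm_polar]
  have key : ∀ (c : ℝ → E3) (c' : E3) (s : ℝ), HasDerivAt c c' s → c s = polar θ φ →
      HasDerivAt (fun t => f (unitVec (c t)))
        (fderiv ℝ (fun x : E3 => f (unitVec x)) (polar θ φ) c') s := fun c c' s hc hs =>
    HasFDerivAt.comp_hasDerivAt (l := fun x : E3 => f (unitVec x)) s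
      (by rw [hs]; exact hf.hasFDerivAt) hc
  have h1 := key (fun t => polar t φ)
    !₂[Real.cos θ * Real.cos φ, Real.cos θ * Real.sin φ, -Real.sin θ] θ (by
      rw [hasDerivAt_iff_hasFDerivAt, ← hasFDerivWithinAt_univ, hasFDerivWithinAt_euclidean]
      intro i
      fin_cases i
      · exact ((Real.hasDerivAt_sin θ).mul_const _).hasFDerivAt.hasFDerivWithinAt
      · exact ((Real.hasDerivAt_sin θ).mul_const _).hasFDerivAt.hasFDerivWithinAt
      · exact (Real.hasDerivAt_cos θ).hasFDerivAt.hasFDerivWithinAt) rfl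
  have h2 := key (fun t => polar θ t)
    !₂[Real.sin θ * -Real.sin φ, Real.sin θ * Real.cos φ, 0] φ (by
      rw [hasDerivAt_iff_hasFDerivAt, ← hasFDerivWithinAt_univ, hasFDerivWithinAt_euclidean]
      intro i
      fin_cases i
      · exact ((Real.hasDerivAt_cos φ).const_mul _).hasFDerivAt.hasFDerivWithinAt
      · exact ((Real.hasDerivAt_sin φ).const_mul _).hasFDerivAt.hasFDerivWithinAt
      · exact (hasDerivAt_const φ (Real.cos θ)).hasFDerivAt.hasFDerivWithinAt) rfl
  have h3 := key (fun t => t • polar θ φ) (polar θ φ) 1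
    (by simpa using (hasDerivAt_id (1 : ℝ)).smul_const (polar θ φ)) (one_smul _ _)
  have h3' : fderiv ℝ (fun x : E3 => f (unitVec x)) (polar θ φ) (polar θ φ) = 0 := by
    refine h3.unique ((hasDerivAt_const (1 : ℝ) (f (polar θ φ))).congr_of_eventuallyEq ?_)
    filter_upwards [lt_mem_nhds (zero_lt_one' ℝ)] with t ht
    simp [unitVec, norm_smul, norm_polar, abs_of_pos ht, smul_smul, ht.ne']
  simp only [hu] at h1 h2
  rw [h1.deriv, h2.deriv]
  funext i
  simp only [surfaceGradient, Pi.add_apply, Pi.smul_apply, toC3, smul_eq_mul]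
  generalize fderiv ℝ (fun x : E3 => f (unitVec x)) (polar θ φ) = D at h3'
  have hs := Real.sin_sq_add_cos_sq θ
  have hp := Real.sin_sq_add_cos_sq φ
  have hD : ∀ v : E3, D v = v 0 * D (EuclideanSpace.single 0 1) +
      v 1 * D (EuclideanSpace.single 1 1) + v 2 * D (EuclideanSpace.single 2 1) := fun v => by
    have hv : v = v 0 • EuclideanSpace.single 0 (1 : ℝ) + v 1 • EuclideanSpace.single 1 (1 : ℝ) +
        v 2 • EuclideanSpace.single 2 (1 : ℝ) := by
      ext j
      fin_cases j <;> simp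
    conv_lhs => rw [hv]
    simp
  rw [hD] at h3'
  rw [hD !₂[Real.cos θ * Real.cos φ, Real.cos θ * Real.sin φ, -Real.sin θ],
    hD !₂[Real.sin θ * -Real.sin φ, Real.sin θ * Real.cos φ, 0]]
  simp only [polar, Matrix.cons_val] at h3' ⊢
  have hc : (Real.sin θ : ℂ) ≠ 0 := by exact_mod_cast hθ
  have hs' : (Real.sin θ : ℂ) ^ 2 + (Real.cos θ : ℂ) ^ 2 = 1 := by exact_mod_cast hs
  have hp' : (Real.sin φ : ℂ) ^ 2 + (Real.cos φ : ℂ) ^ 2 = 1 := by exact_mod_cast hp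
  have fin3 : ∀ j : Fin 3, j = 0 ∨ j = 1 ∨ j = 2 := by decide
  rcases fin3 i with rfl | rfl | rfl <;>
  simp only [Matrix.cons_val, Complex.ofReal_mul, Complex.ofReal_neg, Complex.ofReal_div, Complex.ofReal_one,
    Complex.ofReal_zero] at h3' ⊢
  · generalize (Real.sin θ : ℂ) = s at *
    generalize (Real.cos θ : ℂ) = c at *
    generalize (Real.sin φ : ℂ) = u at *
    generalize (Real.cos φ : ℂ) = v at *
    generalize D (EuclideanSpace.single 0 1) = d0 at *
    generalize D (EuclideanSpace.single 1 1) = d1 at *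
    generalize D (EuclideanSpace.single 2 1) = d2 at *
    have e : 1 / s * (s * -u * d0 + s * v * d1 + 0 * d2) = -u * d0 + v * d1 := by
      field_simp
      ring
    rw [e]
    linear_combination s * v * h3' - (v ^ 2 * d0 + u * v * d1) * hs' - d0 * hp'
  · generalize (Real.sin θ : ℂ) = s at *
    generalize (Real.cos θ : ℂ) = c at *
    generalize (Real.sin φ : ℂ) = u at *
    generalize (Real.cos φ : ℂ) = v at *
    generalize D (EuclideanSpace.single 0 1) = d0 at *
    generalize D (EuclideanSpace.single 1 1) = d1 at *
    generalize D (EuclideanSpace.single 2 1) = d2 at *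
    have e : 1 / s * (s * -u * d0 + s * v * d1 + 0 * d2) = -u * d0 + v * d1 := by
      field_simp
      ring
    rw [e]
    linear_combination s * u * h3' - (u * v * d0 + u ^ 2 * d1) * hs' - d1 * hp'
  · generalize (Real.sin θ : ℂ) = s at *
    generalize (Real.cos θ : ℂ) = c at *
    generalize (Real.sin φ : ℂ) = u at *
    generalize (Real.cos φ : ℂ) = v at *
    generalize D (EuclideanSpace.single 0 1) = d0 at *
    generalize D (EuclideanSpace.single 1 1) = d1 at *
    generalize D (EuclideanSpace.single 2 1) = d2 at *
    have e : 1 / s * (s * -u * d0 + s * v * d1 + 0 * d2) = -u * d0 + v * d1 := by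
      field_simp
      ring
    rw [e]
    linear_combination c * h3' - d2 * hs'

end

end VectorHarmonics

/-!
With `u = x + i y` and `v = x - i y`, attach to `c = (x, y, z)` the quadratic polynomial
`Q_c = v / 2 + z X - u / 2 X ^ 2` (`genPoly`), which is linear in `c`. By Rodrigues' formula the
spherical harmonic `Y_l^m` at a unit vector `w` is a constant times the coefficient of `X ^ (l + m)`
in `Q_w ^ l` (`sphericalY_eq`), so that regular solid harmonics are coefficients of `Q_c ^ l` and
irregular ones are such coefficients divided by `|c| ^ (2 l + 1)`. The fields `W` and `V`, suitably
rescaled, are the gradients of the regular and of the irregular solid harmonics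
(`norm_zpow_smul_vectorW`, `norm_zpow_smul_vectorV`).

The expansion of `W` is the coefficient form of the derivative of the binomial formula for
`(Q_r + Q_a) ^ l` (`derivative_add_pow`).

For the expansion of `V`, a derivative of an irregular solid harmonic of degree `l` in the direction
`e` is a combination of three irregular solid harmonics of degree `l + 1`, the weights being the
coefficients of a polynomial `dualPoly e`, which is `Q_e` read backwards with alternating signs
(`irregular_directional`, which rests on the recurrence `quad_pow_recurrence`). Hence the iterated
derivatives along the line `a + t r` are given by the coefficients of powers of `dualPoly r`. On the
disc `|t| < |a| / |r|` the complexified squared length of `a + t r` avoids the nonpositive reals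
(`dotProduct_mem_slitPlane`), so the irregular solid harmonics extend holomorphically there, and
Taylor's formula at `t = 1` is their addition theorem (`hasSum_irregular`). Applied to the
components of the gradient, it gives the expansion of `V`.

The expansion of `X` is the cross product of `r + a` with the expansion of `V`.
-/

namespace VectorHarmonics

open Polynomial

/-! ### Powers of a quadratic polynomial -/

/-- The quadratic polynomial `α + β X + γ X ^ 2`. -/
noncomputable def quad {R : Type*} [CommRing R] (α β γ : R) : R[X] := C α + C β * X + C γ * X ^ 2

lemma natDegree_quad_le {R : Type*} [CommRing R] (α β γ : R) : (quad α β γ).natDegree ≤ 2 := by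
  unfold quad
  compute_degree

lemma natDegree_quad_pow_le {R : Type*} [CommRing R] (α β γ : R) (k : ℕ) :
    (quad α β γ ^ k).natDegree ≤ 2 * k := by
  have := natDegree_pow_le_of_le k (natDegree_quad_le α β γ)
  omega

lemma natDegree_quad_pow_mul_quad_le {R : Type*} [CommRing R] (α β γ α' β' γ' : R) (k : ℕ) :
    (quad α β γ ^ k * quad α' β' γ').natDegree ≤ 2 * k + 2 :=
  natDegree_mul_le_of_le (natDegree_quad_pow_le α β γ k) (natDegree_quad_le α' β' γ')

lemma reflect_quad {R : Type*} [CommRing R] (α β γ : R) :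
    reflect 2 (quad α β γ) = quad γ β α := by
  have h : revAt 2 1 = 1 := rfl
  have h2 := reflect_C_mul_X_pow 2 1 (c := β)
  rw [pow_one, h, pow_one] at h2
  unfold quad
  rw [reflect_add, reflect_add, reflect_C, h2, reflect_C_mul_X_pow, revAt_le le_rfl]
  simp
  ring

lemma reflect_quad_pow {R : Type*} [CommRing R] (α β γ : R) (k : ℕ) :
    reflect (2 * k) (quad α β γ ^ k) = quad γ β α ^ k := by
  induction k with
  | zero => simp
  | succ k ih =>
    rw [pow_succ, pow_succ, Nat.mul_succ, reflect_mul _ _ (natDegree_quad_pow_le α β γ k)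
      (natDegree_quad_le α β γ), ih, reflect_quad]

lemma coeff_comp_neg_X {R : Type*} [CommRing R] (p : R[X]) (n : ℕ) :
    (p.comp (C (-1) * X)).coeff n = (-1) ^ n * p.coeff n := by
  rw [comp_C_mul_X_coeff, mul_comm]

lemma quad_comp_C_mul_X {R : Type*} [CommRing R] (α β γ s : R) :
    (quad α β γ).comp (C s * X) = quad α (β * s) (γ * s ^ 2) := by
  simp only [quad, add_comp, mul_comp, C_comp, X_comp, pow_comp, C_mul, C_pow]
  ring

/-- Reversing the order of the coefficients and alternating their signs turns `α + β X + γ X ^ 2`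
into `γ - β X + α X ^ 2`, and correspondingly for products. -/
lemma coeff_quad_neg_reverse {R : Type*} [CommRing R] (α β γ α' β' γ' : R) (k j : ℕ)
    (hj : j ≤ 2 * k + 2) :
    (quad γ (-β) α ^ k * quad γ' (-β') α').coeff j =
      (-1) ^ j * (quad α β γ ^ k * quad α' β' γ').coeff (2 * k + 2 - j) := by
  have h1 : quad γ (-β) α ^ k * quad γ' (-β') α' =
      (quad γ β α ^ k * quad γ' β' α').comp (C (-1) * X) := by
    rw [mul_comp, pow_comp, quad_comp_C_mul_X, quad_comp_C_mul_X]
    simp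
  rw [h1, coeff_comp_neg_X, ← reflect_quad_pow, ← reflect_quad α',
    ← reflect_mul _ _ (natDegree_quad_pow_le α β γ k) (natDegree_quad_le α' β' γ'),
    coeff_reflect, revAt_le hj]

lemma coeff_quad_pow_neg_reverse {R : Type*} [CommRing R] (α β γ : R) (k j : ℕ)
    (hj : j ≤ 2 * k) :
    (quad γ (-β) α ^ k).coeff j = (-1) ^ j * (quad α β γ ^ k).coeff (2 * k - j) := by
  have h1 : quad γ (-β) α ^ k = (quad γ β α ^ k).comp (C (-1) * X) := by
    rw [pow_comp, quad_comp_C_mul_X]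
    simp
  rw [h1, coeff_comp_neg_X, ← reflect_quad_pow, coeff_reflect, revAt_le hj]

lemma map_quad {R S : Type*} [CommRing R] [CommRing S] (f : R →+* S) (α β γ : R) :
    (quad α β γ).map f = quad (f α) (f β) (f γ) := by
  simp [quad]

lemma C_mul_quad {R : Type*} [CommRing R] (s α β γ : R) :
    C s * quad α β γ = quad (s * α) (s * β) (s * γ) := by
  simp only [quad, C_mul]
  ring

lemma derivative_quad {R : Type*} [CommRing R] (α β γ : R) :
    derivative (quad α β γ) = C β + C (2 * γ) * X := by
  simp only [quad, derivative_add, derivative_C, derivative_mul, derivative_X, derivative_X_pow]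
  simp
  ring

lemma coeff_X_mul_derivative {R : Type*} [CommRing R] (p : R[X]) (n : ℕ) :
    (X * derivative p).coeff n = n * p.coeff n := by
  cases n with
  | zero => simp
  | succ n =>
    rw [coeff_X_mul, coeff_derivative]
    push_cast
    ring

/-- The recurrence relation for the coefficients of powers of `Q = α + β X + γ X ^ 2` behind the
formula for the derivative of an irregular solid harmonic: with `β ^ 2 - 4 α γ` in the place of
`|x| ^ 2`, the left-hand side is (up to a factor) the numerator of the directional derivative of
`[X ^ n] Q ^ l / |x| ^ (2 l + 1)`. -/
lemma quad_pow_recurrence {R : Type*} [CommRing R] (α β γ α' β' γ' : R) (l n : ℕ) :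
    (l + 1) * ((β ^ 2 - 4 * α * γ) * (l * (quad α β γ ^ (l - 1) * quad α' β' γ').coeff n) -
      (2 * l + 1) * (β * β' - 2 * γ * α' - 2 * α * γ') * (quad α β γ ^ l).coeff n) =
    α' * ((n + 2) * (n + 1) * (quad α β γ ^ (l + 1)).coeff (n + 2)) +
      -β' * ((n + 1) * (2 * l + 1 - n) * (quad α β γ ^ (l + 1)).coeff (n + 1)) +
      γ' * ((2 * l + 2 - n) * (2 * l + 1 - n) * (quad α β γ ^ (l + 1)).coeff n) := by
  set Q := quad α β γ with hQ
  set P := Q ^ (l + 1) with hP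
  have h1 : derivative P = C ((l : R) + 1) * Q ^ l * (C β + C (2 * γ) * X) := by
    rw [hP, derivative_pow, hQ, derivative_quad]
    simp
  have h2 : derivative (derivative P) = C ((l : R) + 1) *
      (C (l : R) * Q ^ (l - 1) * (C β + C (2 * γ) * X) ^ 2 + Q ^ l * C (2 * γ)) := by
    rw [h1, derivative_mul, derivative_C_mul, derivative_pow, hQ, derivative_quad]
    simp
    ring
  have h3 : C ((l : R) + 1) * (C (β ^ 2 - 4 * α * γ) * (C (l : R) * (Q ^ (l - 1) * quad α' β' γ')) -
      C ((2 * l + 1) * (β * β' - 2 * γ * α' - 2 * α * γ')) * Q ^ l) =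
      C α' * derivative (derivative P) +
      C (-β') * (C (2 * (l : R) + 1) * derivative P - X * derivative (derivative P)) +
      C γ' * (X * derivative (X * derivative P) - C (4 * (l : R) + 3) * (X * derivative P) +
        C ((2 * (l : R) + 2) * (2 * l + 1)) * P) := by
    rw [derivative_mul, derivative_X, h2, h1, hP]
    cases l with
    | zero =>
      simp only [hQ, quad, map_add, map_mul, map_sub, map_pow, map_neg, map_ofNat,
        map_one, map_zero, Nat.cast_zero]
      ring
    | succ k =>
      rw [Nat.add_sub_cancel, pow_succ Q (k + 1), pow_succ Q k]
      generalize Q ^ k = G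
      simp only [hQ, quad, map_add, map_mul, map_sub, map_pow, map_neg, map_ofNat, map_natCast,
        map_one, Nat.cast_succ]
      ring
  have h4 := congrArg (fun p => coeff p n) h3
  simp only [coeff_add, coeff_sub, coeff_C_mul, coeff_X_mul_derivative, coeff_derivative] at h4
  push_cast at h4 ⊢
  linear_combination h4

/-- Multiplying by a quadratic polynomial moves, by summation by parts, to the weights. -/
lemma sum_coeff_mul_quad {R : Type*} [CommRing R] (p : R[X]) (N : ℕ) (hp : p.natDegree ≤ N)
    (α β γ : R) (φ : ℕ → R) :
    ∑ j ∈ Finset.range (N + 3), (p * quad α β γ).coeff j * φ j =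
      ∑ j ∈ Finset.range (N + 1),
        p.coeff j * (α * φ j + β * φ (j + 1) + γ * φ (j + 2)) := by
  let L : (ℕ → R) → R[X] →ₗ[R] R := fun ψ => lsum fun j => LinearMap.mulRight R (ψ j)
  have hL : ∀ ψ q M, q.natDegree < M → L ψ q = ∑ j ∈ Finset.range M, q.coeff j * ψ j :=
    fun ψ q M hq => sum_over_range' q (by simp) M hq
  have hpq : (p * quad α β γ).natDegree < N + 3 :=
    Nat.lt_succ_of_le (natDegree_mul_le_of_le hp (natDegree_quad_le α β γ))
  rw [← hL φ _ _ hpq,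
    ← hL (fun j => α * φ j + β * φ (j + 1) + γ * φ (j + 2)) _ _ (Nat.lt_succ_of_le hp)]
  have key : L φ ∘ₗ LinearMap.mulRight R (quad α β γ) =
      L (fun j => α * φ j + β * φ (j + 1) + γ * φ (j + 2)) := by
    refine lhom_ext' fun n => LinearMap.ext_ring ?_
    have hm : (monomial n (1 : R)) * quad α β γ =
        monomial n α + monomial (n + 1) β + monomial (n + 2) γ := by
      simp only [quad, ← C_mul_X_pow_eq_monomial, map_one]
      ring
    change L φ (monomial n 1 * quad α β γ) = L _ (monomial n 1)
    rw [hm, map_add, map_add]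
    simp [L, lsum_apply, sum_monomial_index]
  exact congrArg (fun f => f p) key

/-! ### The generating polynomial of the solid harmonics -/

/-- The quadratic polynomial `(x - i y) / 2 + z X - (x + i y) / 2 X ^ 2` attached to
`c = (x, y, z) ∈ ℂ³`. -/
noncomputable def genPoly (c : Fin 3 → ℂ) : ℂ[X] :=
  quad ((c 0 - Complex.I * c 1) / 2) (c 2) (-(c 0 + Complex.I * c 1) / 2)

/-- The polynomial `genPoly c` with its coefficients in reverse order and with alternating signs.
It is the symbol of the derivative in the direction `c` acting on irregular solid harmonics. -/
noncomputable def dualPoly (c : Fin 3 → ℂ) : ℂ[X] :=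
  quad (-(c 0 + Complex.I * c 1) / 2) (-c 2) ((c 0 - Complex.I * c 1) / 2)

lemma genPoly_add (c d : Fin 3 → ℂ) : genPoly (c + d) = genPoly c + genPoly d := by
  have h1 : (c 0 + d 0 - Complex.I * (c 1 + d 1)) / 2 =
    (c 0 - Complex.I * c 1) / 2 + (d 0 - Complex.I * d 1) / 2 := by ring
  have h2 : -(c 0 + d 0 + Complex.I * (c 1 + d 1)) / 2 =
    -(c 0 + Complex.I * c 1) / 2 + -(d 0 + Complex.I * d 1) / 2 := by ring
  simp only [genPoly, quad, Pi.add_apply, h1, h2, map_add]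
  ring

lemma genPoly_smul (t : ℂ) (c : Fin 3 → ℂ) : genPoly (t • c) = C t * genPoly c := by
  have h1 : (t * c 0 - Complex.I * (t * c 1)) / 2 = t * ((c 0 - Complex.I * c 1) / 2) := by ring
  have h2 : -(t * c 0 + Complex.I * (t * c 1)) / 2 = t * (-(c 0 + Complex.I * c 1) / 2) := by ring
  simp only [genPoly, quad, Pi.smul_apply, smul_eq_mul, h1, h2, map_mul]
  ring

lemma coeff_genPoly_smul_pow (t : ℂ) (c : Fin 3 → ℂ) (l n : ℕ) :
    (genPoly (t • c) ^ l).coeff n = t ^ l * (genPoly c ^ l).coeff n := by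
  rw [genPoly_smul, mul_pow, ← C_pow, coeff_C_mul]

lemma coeff_genPoly_smul_pow_mul (t : ℂ) (c e : Fin 3 → ℂ) (l n : ℕ) :
    (genPoly (t • c) ^ l * genPoly e).coeff n = t ^ l * (genPoly c ^ l * genPoly e).coeff n := by
  rw [genPoly_smul, mul_pow, ← C_pow, mul_assoc, coeff_C_mul]

lemma natDegree_genPoly_pow_le (c : Fin 3 → ℂ) (k : ℕ) : (genPoly c ^ k).natDegree ≤ 2 * k :=
  natDegree_quad_pow_le _ _ _ k

lemma natDegree_genPoly_pow_mul_le (c e : Fin 3 → ℂ) (k : ℕ) :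
    (genPoly c ^ k * genPoly e).natDegree ≤ 2 * k + 2 :=
  natDegree_quad_pow_mul_quad_le _ _ _ _ _ _ k

/-- The signs `(-1) ^ (ν + μ)` in the irregular addition theorem come from this reversal. -/
lemma coeff_dualPoly_pow_mul (c e : Fin 3 → ℂ) (k j : ℕ) (hj : j ≤ 2 * k + 2) :
    (dualPoly c ^ k * dualPoly e).coeff j =
      (-1) ^ j * (genPoly c ^ k * genPoly e).coeff (2 * k + 2 - j) :=
  coeff_quad_neg_reverse _ _ _ _ _ _ k j hj

/-- Coefficientwise product rule for families of polynomials depending on a parameter. -/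
lemma hasDerivAt_coeff_mul {P R : ℂ → ℂ[X]} {P' R' : ℂ[X]} {t : ℂ}
    (hP : ∀ n, HasDerivAt (fun s => (P s).coeff n) (P'.coeff n) t)
    (hR : ∀ n, HasDerivAt (fun s => (R s).coeff n) (R'.coeff n) t) (n : ℕ) :
    HasDerivAt (fun s => (P s * R s).coeff n) ((P' * R t + P t * R').coeff n) t := by
  simp only [coeff_add, coeff_mul, ← Finset.sum_add_distrib]
  exact HasDerivAt.fun_sum fun i _ => (hP i.1).mul (hR i.2)

/-- The derivative along a line of the coefficients of the powers of `genPoly`. -/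
lemma hasDerivAt_coeff_genPoly_pow (a e : Fin 3 → ℂ) (l n : ℕ) (t : ℂ) :
    HasDerivAt (fun s : ℂ => (genPoly (a + s • e) ^ l).coeff n)
      (l * (genPoly (a + t • e) ^ (l - 1) * genPoly e).coeff n) t := by
  have h1 : ∀ n, HasDerivAt (fun s : ℂ => (genPoly (a + s • e)).coeff n)
      ((genPoly e).coeff n) t := by
    intro n
    simp only [genPoly_add, genPoly_smul, coeff_add, coeff_C_mul]
    simpa using ((hasDerivAt_id t).mul_const ((genPoly e).coeff n)).const_add
      ((genPoly a).coeff n)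
  have h2 : ∀ n, HasDerivAt (fun s : ℂ => (genPoly (a + s • e) ^ l).coeff n)
      ((C (l : ℂ) * (genPoly (a + t • e) ^ (l - 1) * genPoly e)).coeff n) t := by
    induction l with
    | zero => intro n; simpa using hasDerivAt_const t _
    | succ l ih =>
      intro n
      have h := hasDerivAt_coeff_mul ih h1 n
      simp only [← pow_succ] at h
      convert h using 2
      cases l with
      | zero => simp
      | succ k =>
        simp only [Nat.add_sub_cancel, Nat.cast_succ, map_add, map_one]
        ring
  simpa only [coeff_C_mul] using h2 n

/-! ### Irregular solid harmonics and their derivatives -/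

/-- The irregular solid harmonic of degree `l` and order `n - l`, up to a constant factor,
at `c ∈ ℂ³`. The number `s` stands for the inverse of the length of `c`, which makes the function
available for complex `c`. -/
noncomputable def irregular (l n : ℕ) (c : Fin 3 → ℂ) (s : ℂ) : ℂ :=
  (n.factorial : ℂ) * ((2 * l - n).factorial : ℂ) / (l.factorial : ℂ) *
    (genPoly c ^ l).coeff n * s ^ (2 * l + 1)

/-- The derivative of an irregular solid harmonic in the direction `e` is a combination of three
irregular solid harmonics of the next degree. -/
lemma irregular_directional (l n : ℕ) (hn : n ≤ 2 * l) (c e : Fin 3 → ℂ) (s : ℂ)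
    (hs : s ^ 2 * (c ⬝ᵥ c) = 1) :
    (n.factorial : ℂ) * ((2 * l - n).factorial : ℂ) / (l.factorial : ℂ) *
      (l * (genPoly c ^ (l - 1) * genPoly e).coeff n * s ^ (2 * l + 1) -
        (2 * l + 1) * (c ⬝ᵥ e) * (genPoly c ^ l).coeff n * s ^ (2 * l + 3)) =
    ∑ j ∈ Finset.range 3, (dualPoly e).coeff j * irregular (l + 1) (n + j) c s := by
  have hrec := quad_pow_recurrence ((c 0 - Complex.I * c 1) / 2) (c 2)
    (-(c 0 + Complex.I * c 1) / 2) ((e 0 - Complex.I * e 1) / 2) (e 2)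
    (-(e 0 + Complex.I * e 1) / 2) l n
  have hcc : (c 2) ^ 2 - 4 * ((c 0 - Complex.I * c 1) / 2) * (-(c 0 + Complex.I * c 1) / 2) =
      c ⬝ᵥ c := by
    rw [dotProduct, Fin.sum_univ_three]
    linear_combination -(c 1) ^ 2 * Complex.I_sq
  have hce : c 2 * e 2 - 2 * (-(c 0 + Complex.I * c 1) / 2) * ((e 0 - Complex.I * e 1) / 2) -
      2 * ((c 0 - Complex.I * c 1) / 2) * (-(e 0 + Complex.I * e 1) / 2) = c ⬝ᵥ e := by
    rw [dotProduct, Fin.sum_univ_three]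
    linear_combination -(c 1) * (e 1) * Complex.I_sq
  rw [hcc, hce] at hrec
  change (l + 1 : ℂ) * ((c ⬝ᵥ c) * (l * (genPoly c ^ (l - 1) * genPoly e).coeff n) -
    (2 * l + 1) * (c ⬝ᵥ e) * (genPoly c ^ l).coeff n) =
    _ * (_ * (genPoly c ^ (l + 1)).coeff (n + 2)) + _ * (_ * (genPoly c ^ (l + 1)).coeff (n + 1)) +
    _ * (_ * (genPoly c ^ (l + 1)).coeff n) at hrec
  obtain ⟨k, hk⟩ := Nat.exists_eq_add_of_le hn
  have e0 : 2 * (l + 1) - n = k + 2 := by omega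
  have e1 : 2 * (l + 1) - (n + 1) = k + 1 := by omega
  have e2 : 2 * (l + 1) - (n + 2) = k := by omega
  have e3 : 2 * l - n = k := by omega
  have hkc : (k : ℂ) = 2 * l - n := by
    rw [eq_sub_iff_add_eq']
    exact_mod_cast hk.symm
  have hl : (l : ℂ) + 1 ≠ 0 := Nat.cast_add_one_ne_zero l
  have hl' : (l.factorial : ℂ) ≠ 0 := Nat.cast_ne_zero.2 l.factorial_ne_zero
  have d0 : (dualPoly e).coeff 0 = -(e 0 + Complex.I * e 1) / 2 := by
    simp [dualPoly, quad]
  have d1 : (dualPoly e).coeff 1 = -e 2 := by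
    simp [dualPoly, quad, coeff_C]
  have d2 : (dualPoly e).coeff 2 = (e 0 - Complex.I * e 1) / 2 := by
    simp [dualPoly, quad]
  have hs1 : s ^ (2 * l + 1) = s ^ (2 * l + 3) * (c ⬝ᵥ c) := by
    linear_combination -s ^ (2 * l + 1) * hs
  simp only [Finset.sum_range_succ, Finset.sum_range_zero, irregular, d0, d1, d2, e0, e1, e2, e3,
    add_zero, zero_add, Nat.factorial_succ, hs1, show 2 * (l + 1) + 1 = 2 * l + 3 from rfl]
  push_cast
  rw [hkc]
  field_simp
  linear_combination 2 * (n.factorial : ℂ) * (k.factorial : ℂ) * s ^ (2 * l + 3) * hrec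

/-- The derivative of an irregular solid harmonic along a line, where `s` is a differentiable
branch of the inverse length. -/
lemma hasDerivAt_irregular (l n : ℕ) (hn : n ≤ 2 * l) (a e : Fin 3 → ℂ) (s : ℂ → ℂ) (t : ℂ)
    (hs : s t ^ 2 * ((a + t • e) ⬝ᵥ (a + t • e)) = 1)
    (hs' : HasDerivAt s (-(s t ^ 3 * ((a + t • e) ⬝ᵥ e))) t) :
    HasDerivAt (fun t => irregular l n (a + t • e) (s t))
      (∑ j ∈ Finset.range 3, (dualPoly e).coeff j * irregular (l + 1) (n + j) (a + t • e) (s t))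
      t := by
  rw [← irregular_directional l n hn _ e _ hs]
  have h := ((hasDerivAt_coeff_genPoly_pow a e l n t).const_mul
    ((n.factorial : ℂ) * ((2 * l - n).factorial : ℂ) / (l.factorial : ℂ))).mul
    (hs'.fun_pow (2 * l + 1))
  refine h.congr_deriv ?_
  rw [Nat.add_sub_cancel]
  push_cast
  ring

/-- Differentiating a combination of irregular solid harmonics along `e` amounts to multiplying the
polynomial formed by its weights by `dualPoly e`. The bound on `n + N` keeps every index in the range
where `hasDerivAt_irregular` holds. -/
lemma hasDerivAt_sum_irregular (L n N : ℕ) (p : ℂ[X]) (hp : p.natDegree ≤ N)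
    (hn : n + N ≤ 2 * L) (a e : Fin 3 → ℂ) (s : ℂ → ℂ) (t : ℂ)
    (hs : s t ^ 2 * ((a + t • e) ⬝ᵥ (a + t • e)) = 1)
    (hs' : HasDerivAt s (-(s t ^ 3 * ((a + t • e) ⬝ᵥ e))) t) :
    HasDerivAt (fun t => ∑ j ∈ Finset.range (N + 1),
        p.coeff j * irregular L (n + j) (a + t • e) (s t))
      (∑ j ∈ Finset.range (N + 3),
        (p * dualPoly e).coeff j * irregular (L + 1) (n + j) (a + t • e) (s t)) t := by
  have h := HasDerivAt.fun_sum (u := Finset.range (N + 1)) fun j hj =>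
    (hasDerivAt_irregular L (n + j) (by have := Finset.mem_range.1 hj; omega) a e s t hs
      hs').const_mul (p.coeff j)
  refine h.congr_deriv ?_
  rw [dualPoly, sum_coeff_mul_quad p N hp, ← dualPoly]
  refine Finset.sum_congr rfl fun j _ => ?_
  simp [Finset.sum_range_succ, dualPoly, quad, coeff_X, coeff_C, add_assoc]

/-! ### Taylor expansion of irregular solid harmonics -/

lemma toC3_add (a b : E3) : toC3 (a + b) = toC3 a + toC3 b := by
  ext i
  simp [toC3]

lemma toC3_smul (t : ℝ) (a : E3) : toC3 (t • a) = (t : ℂ) • toC3 a := by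
  ext i
  simp [toC3]

lemma toC3_dotProduct (a b : E3) : toC3 a ⬝ᵥ toC3 b = ((inner ℝ a b : ℝ) : ℂ) := by
  simp only [dotProduct, toC3, Fin.sum_univ_three, PiLp.inner_apply]
  simp
  ring

lemma toC3_dotProduct_self (a : E3) : toC3 a ⬝ᵥ toC3 a = ((‖a‖ ^ 2 : ℝ) : ℂ) := by
  rw [toC3_dotProduct, real_inner_self_eq_norm_sq]

lemma dotProduct_add_smul_self (A R : Fin 3 → ℂ) (t : ℂ) :
    (A + t • R) ⬝ᵥ (A + t • R) = A ⬝ᵥ A + 2 * t * (A ⬝ᵥ R) + t ^ 2 * (R ⬝ᵥ R) := by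
  simp only [dotProduct, Fin.sum_univ_three, Pi.add_apply, Pi.smul_apply, smul_eq_mul]
  ring

/-- For complex `t` with `|t| |r| < |a|`, the complexified squared length of `a + t r` is not a
nonpositive real number. -/
lemma dotProduct_mem_slitPlane (a r : E3) (t : ℂ) (ht : ‖t‖ * ‖r‖ < ‖a‖) :
    (toC3 a + t • toC3 r) ⬝ᵥ (toC3 a + t • toC3 r) ∈ Complex.slitPlane := by
  have hq := dotProduct_add_smul_self (toC3 a) (toC3 r) t
  rw [toC3_dotProduct_self, toC3_dotProduct_self, toC3_dotProduct] at hq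
  have him : ((toC3 a + t • toC3 r) ⬝ᵥ (toC3 a + t • toC3 r)).im =
      2 * t.im * (inner ℝ a r + t.re * ‖r‖ ^ 2) := by
    rw [hq]
    simp only [pow_two, Complex.add_im, Complex.mul_im, Complex.mul_re, Complex.ofReal_re,
      Complex.ofReal_im, Complex.re_ofNat, Complex.im_ofNat]
    ring
  have hre : ((toC3 a + t • toC3 r) ⬝ᵥ (toC3 a + t • toC3 r)).re =
      ‖a‖ ^ 2 + 2 * t.re * inner ℝ a r + (t.re ^ 2 - t.im ^ 2) * ‖r‖ ^ 2 := by
    rw [hq]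
    simp only [pow_two, Complex.add_re, Complex.mul_im, Complex.mul_re, Complex.ofReal_re,
      Complex.ofReal_im, Complex.re_ofNat, Complex.im_ofNat]
    ring
  have hlt : (t.re ^ 2 + t.im ^ 2) * ‖r‖ ^ 2 < ‖a‖ ^ 2 := by
    have h := pow_lt_pow_left₀ ht (by positivity) two_ne_zero
    rw [mul_pow, Complex.sq_norm, Complex.normSq_apply] at h
    linarith
  rw [Complex.mem_slitPlane_iff, or_iff_not_imp_right, not_not, him, hre]
  intro h0
  rcases mul_eq_zero.1 h0 with h | h
  · have hy : t.im = 0 := by linarith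
    -- for real `t` the value is `|a + t r| ^ 2`
    have hn : ‖a‖ ^ 2 + 2 * t.re * inner ℝ a r + t.re ^ 2 * ‖r‖ ^ 2 = ‖a + t.re • r‖ ^ 2 := by
      rw [norm_add_sq_real, inner_smul_right, norm_smul, mul_pow, Real.norm_eq_abs, sq_abs]
      ring
    have hpos : a + t.re • r ≠ 0 := by
      intro h1
      have h2 : ‖a‖ ^ 2 = t.re ^ 2 * ‖r‖ ^ 2 := by
        rw [eq_neg_of_add_eq_zero_left h1, norm_neg, norm_smul, mul_pow, Real.norm_eq_abs, sq_abs]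
      rw [hy, h2] at hlt
      linarith
    have := pow_pos (norm_pos_iff.2 hpos) 2
    rw [hy]
    linarith
  · have h1 : (inner ℝ a r : ℝ) = -(t.re * ‖r‖ ^ 2) := by linarith
    rw [h1]
    linarith

/-- The branch of the inverse length `(c ⬝ c) ^ (-1/2)` given by the principal power. -/
noncomputable def invLength (c : Fin 3 → ℂ) : ℂ := (c ⬝ᵥ c) ^ (-(1 / 2) : ℂ)

lemma invLength_sq_mul (c : Fin 3 → ℂ) (hc : c ⬝ᵥ c ∈ Complex.slitPlane) :
    invLength c ^ 2 * (c ⬝ᵥ c) = 1 := by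
  rw [invLength, ← Complex.cpow_nat_mul]
  norm_num
  rw [Complex.cpow_neg_one, inv_mul_cancel₀ (Complex.slitPlane_ne_zero hc)]

lemma invLength_toC3 (a : E3) : invLength (toC3 a) = ((‖a‖ : ℝ) : ℂ)⁻¹ := by
  have h : (-(1 / 2) : ℂ) = ((-(1 / 2) : ℝ) : ℂ) := by push_cast; ring
  rw [invLength, toC3_dotProduct_self, h, ← Complex.ofReal_cpow (by positivity),
    Real.rpow_neg (by positivity), ← Real.sqrt_eq_rpow, Real.sqrt_sq (norm_nonneg a),
    Complex.ofReal_inv]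

lemma hasDerivAt_invLength (A R : Fin 3 → ℂ) (t : ℂ)
    (h : (A + t • R) ⬝ᵥ (A + t • R) ∈ Complex.slitPlane) :
    HasDerivAt (fun t => invLength (A + t • R))
      (-(invLength (A + t • R) ^ 3 * ((A + t • R) ⬝ᵥ R))) t := by
  have hq : HasDerivAt (fun t : ℂ => (A + t • R) ⬝ᵥ (A + t • R)) (2 * ((A + t • R) ⬝ᵥ R)) t := by
    simp only [dotProduct_add_smul_self]
    have h1 := (((hasDerivAt_id t).const_mul 2).mul_const (A ⬝ᵥ R)).const_add (A ⬝ᵥ A)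
    refine (h1.add ((hasDerivAt_pow 2 t).mul_const (R ⬝ᵥ R))).congr_deriv ?_
    simp only [add_dotProduct, smul_dotProduct, smul_eq_mul]
    push_cast
    ring
  refine (hq.cpow_const (c := (-(1 / 2) : ℂ)) h).congr_deriv ?_
  rw [invLength, ← Complex.cpow_nat_mul]
  have : (-(1 / 2) - 1 : ℂ) = ((3 : ℕ) : ℂ) * -(1 / 2) := by push_cast; ring
  rw [this]
  ring

/-- The addition theorem for irregular solid harmonics, in the form of Taylor's formula along the
segment from `a` to `a + r`: the function extends holomorphically to the complex parameters `t`
with `|t| < |a| / |r|`, a disc that contains `t = 1`. -/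
theorem hasSum_irregular (a r : E3) (hr : r ≠ 0) (ha : ‖r‖ < ‖a‖) (L n N : ℕ) (p : ℂ[X])
    (hp : p.natDegree ≤ N) (hn : n + N ≤ 2 * L) :
    HasSum (fun k : ℕ => (k.factorial : ℂ)⁻¹ * ∑ j ∈ Finset.range (N + 2 * k + 1),
        (p * dualPoly (toC3 r) ^ k).coeff j *
          irregular (L + k) (n + j) (toC3 a) ((‖a‖ : ℝ) : ℂ)⁻¹)
      (∑ j ∈ Finset.range (N + 1),
        p.coeff j * irregular L (n + j) (toC3 (r + a)) ((‖r + a‖ : ℝ) : ℂ)⁻¹) := by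
  have hrpos := norm_pos_iff.2 hr
  set F : ℕ → ℂ → ℂ := fun k t => ∑ j ∈ Finset.range (N + 2 * k + 1),
    (p * dualPoly (toC3 r) ^ k).coeff j *
      irregular (L + k) (n + j) (toC3 a + t • toC3 r) (invLength (toC3 a + t • toC3 r)) with hF
  have hslit : ∀ t ∈ Metric.ball (0 : ℂ) (‖a‖ / ‖r‖),
      (toC3 a + t • toC3 r) ⬝ᵥ (toC3 a + t • toC3 r) ∈ Complex.slitPlane := by
    intro t ht
    rw [mem_ball_zero_iff, lt_div_iff₀ hrpos] at ht
    exact dotProduct_mem_slitPlane a r t ht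
  have hdeg : ∀ k, (p * dualPoly (toC3 r) ^ k).natDegree ≤ N + 2 * k := fun k =>
    natDegree_mul_le_of_le hp (natDegree_quad_pow_le _ _ _ k)
  have hder : ∀ k, ∀ t ∈ Metric.ball (0 : ℂ) (‖a‖ / ‖r‖), HasDerivAt (F k) (F (k + 1) t) t := by
    intro k t ht
    have h := hasDerivAt_sum_irregular (L + k) n (N + 2 * k) _ (hdeg k) (by omega) (toC3 a)
      (toC3 r) (fun t => invLength (toC3 a + t • toC3 r)) t (invLength_sq_mul _ (hslit t ht))
      (hasDerivAt_invLength _ _ t (hslit t ht))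
    rw [mul_assoc, ← pow_succ] at h
    exact h
  have hiter : ∀ k, ∀ t ∈ Metric.ball (0 : ℂ) (‖a‖ / ‖r‖), iteratedDeriv k (F 0) t = F k t := by
    intro k
    induction k with
    | zero => intro t _; simp
    | succ k ih =>
      intro t ht
      rw [iteratedDeriv_succ]
      refine ((hder k t ht).congr_of_eventuallyEq ?_).deriv
      filter_upwards [Metric.isOpen_ball.mem_nhds ht] with u hu using ih u hu
  have h1 : (1 : ℂ) ∈ Metric.ball (0 : ℂ) (‖a‖ / ‖r‖) := by
    rw [mem_ball_zero_iff, norm_one, one_lt_div hrpos]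
    exact ha
  have h0 : (0 : ℂ) ∈ Metric.ball (0 : ℂ) (‖a‖ / ‖r‖) :=
    Metric.mem_ball_self (zero_lt_one.trans ((one_lt_div hrpos).2 ha))
  have hsum := Complex.hasSum_taylorSeries_on_ball
    (fun t ht => (hder 0 t ht).differentiableAt.differentiableWithinAt) h1
  have hF1 : F 0 1 = ∑ j ∈ Finset.range (N + 1),
      p.coeff j * irregular L (n + j) (toC3 (r + a)) ((‖r + a‖ : ℝ) : ℂ)⁻¹ := by
    simp only [hF, one_smul, ← toC3_add, add_comm a r, invLength_toC3]
    simp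
  rw [hF1] at hsum
  simp only [hiter _ 0 h0] at hsum
  simpa [hF, invLength_toC3] using hsum

/-! ### Spherical harmonics as coefficients of the generating polynomial -/

lemma iterate_derivative_eval {R : Type*} [CommRing R] (p : R[X]) (k : ℕ) (z : R) :
    (derivative^[k] p).eval z = k.factorial * (taylor z p).coeff k := by
  rw [taylor_coeff, ← factorial_smul_hasseDeriv]
  simp

/-- Rodrigues' formula, read as an expansion of `((z + X) ^ 2 - 1) ^ l` in powers of `X`. -/
lemma iterate_derivative_legendreP_eval (l m : ℕ) (z : ℝ) :
    (derivative^[m] (legendreP l)).eval z = ((2 : ℝ) ^ l * l.factorial)⁻¹ *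
      ((l + m).factorial * (quad (z ^ 2 - 1) (2 * z) 1 ^ l).coeff (l + m)) := by
  have h : (taylor z) (X ^ 2 - 1 : ℝ[X]) = quad (z ^ 2 - 1) (2 * z) 1 := by
    rw [taylor_apply]
    simp only [quad, sub_comp, pow_comp, X_comp, one_comp, map_sub, map_mul, map_pow, map_one,
      map_ofNat]
    ring
  rw [legendreP, iterate_derivative_C_mul, ← Function.iterate_add_apply, eval_C_mul,
    iterate_derivative_eval, taylor_pow, h, add_comm m l]

/-- On the sphere `u v = 1 - z ^ 2` the substitution `X ↦ -u X` carries `(z + X) ^ 2 - 1` to a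
multiple of the generating polynomial. -/
lemma coeff_legendre_eq (u v z : ℂ) (huv : u * v = 1 - z ^ 2) (h0 : u = 0 → v = 0) (l m : ℕ) :
    (-u) ^ m * (quad (z ^ 2 - 1) (2 * z) 1 ^ l).coeff (l + m) =
      2 ^ l * (quad (v / 2) z (-u / 2) ^ l).coeff (l + m) := by
  rcases eq_or_ne u 0 with rfl | hu
  -- at the poles only the order `m = 0` survives
  · rw [h0 rfl, show z ^ 2 - 1 = 0 by linear_combination huv]
    have e1 : quad (0 / 2 : ℂ) z (-0 / 2) = C z * X := by simp [quad]
    have e2 : quad 0 (2 * z) 1 = X * (C (2 * z) + X) := by simp [quad]; ring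
    have e3 : (((C (2 * z) + X) ^ l).coeff 0) = (2 * z) ^ l := by
      simp [coeff_zero_eq_eval_zero]
    rw [e1, e2, mul_pow, mul_pow, ← C_pow, coeff_C_mul, add_comm l m, coeff_X_pow_mul, coeff_X_pow]
    rcases Nat.eq_zero_or_pos m with rfl | hm
    · rw [e3]
      simp [mul_pow]
    · rw [if_neg (by omega)]
      simp [hm.ne']
  · have e1 : (quad (z ^ 2 - 1) (2 * z) 1).comp (C (-u) * X) =
        C (-2 * u) * quad (v / 2) z (-u / 2) := by
      have c1 : z ^ 2 - 1 = -2 * u * (v / 2) := by linear_combination huv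
      have c2 : 2 * z * -u = -2 * u * z := by ring
      have c3 : 1 * (-u) ^ 2 = -2 * u * (-u / 2) := by ring
      rw [quad_comp_C_mul_X, c1, c2, c3, C_mul_quad]
    have e2 := congrArg (fun p => (p ^ l).coeff (l + m)) e1
    simp only [← pow_comp, comp_C_mul_X_coeff, mul_pow, ← C_pow, coeff_C_mul] at e2
    apply mul_left_cancel₀ (pow_ne_zero l (neg_ne_zero.2 hu))
    rw [show (-2 : ℂ) = 2 * -1 by ring, mul_pow, mul_assoc _ ((-1) ^ l), ← mul_pow, neg_one_mul,
      pow_add] at e2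
    linear_combination e2

/-- The normalisation of the spherical harmonic of degree `l` and order `m` relative to the
coefficients of `genPoly`, where `n = l + m` and `k = l - m`. -/
noncomputable def harmonicNorm (l n k : ℕ) : ℝ :=
  Real.sqrt ((2 * (l : ℝ) + 1) / (4 * Real.pi) * (n.factorial * k.factorial)) / l.factorial

lemma sphericalYNonneg_eq (l m : ℕ) (w : E3) (hw : ‖w‖ = 1) :
    sphericalYNonneg l m w =
      (harmonicNorm l (l + m) (l - m) : ℂ) * (genPoly (toC3 w) ^ l).coeff (l + m) := by
  set u : ℂ := (w 0 : ℂ) + Complex.I * (w 1 : ℂ) with hu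
  set v : ℂ := (w 0 : ℂ) - Complex.I * (w 1 : ℂ) with hv
  have hsq : w 0 ^ 2 + w 1 ^ 2 + w 2 ^ 2 = 1 := by
    have h := EuclideanSpace.norm_sq_eq w
    rw [hw, Fin.sum_univ_three] at h
    simpa using h.symm
  have hsqc : (w 0 : ℂ) ^ 2 + (w 1 : ℂ) ^ 2 + (w 2 : ℂ) ^ 2 = 1 := by
    have h := congrArg (fun x : ℝ => (x : ℂ)) hsq
    push_cast at h
    exact h
  have huv : u * v = 1 - (w 2 : ℂ) ^ 2 := by
    rw [hu, hv]
    linear_combination hsqc - (w 1 : ℂ) ^ 2 * Complex.I_sq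
  have h0 : u = 0 → v = 0 := by
    intro h
    have h1 := congrArg Complex.re h
    have h2 := congrArg Complex.im h
    simp [hu] at h1 h2
    simp [hv, h1, h2]
  have hcoef : (((quad (w 2 ^ 2 - 1) (2 * w 2) 1 ^ l).coeff (l + m) : ℝ) : ℂ) =
      (quad ((w 2 : ℂ) ^ 2 - 1) (2 * (w 2 : ℂ)) 1 ^ l).coeff (l + m) := by
    have h1 : (quad (w 2 ^ 2 - 1) (2 * w 2) 1).map Complex.ofRealHom =
        quad ((w 2 : ℂ) ^ 2 - 1) (2 * (w 2 : ℂ)) 1 := by simp [map_quad]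
    rw [← h1, ← Polynomial.map_pow, coeff_map]
    rfl
  have hkey := coeff_legendre_eq u v (w 2) huv h0 l m
  have hgen : genPoly (toC3 w) = quad (v / 2) (w 2 : ℂ) (-u / 2) := rfl
  have hsqrt : Real.sqrt ((2 * (l : ℝ) + 1) / (4 * Real.pi) *
      (((l - m).factorial : ℝ) / ((l + m).factorial : ℝ))) * (l + m).factorial =
      harmonicNorm l (l + m) (l - m) * l.factorial := by
    have hp : (0 : ℝ) < (l + m).factorial := Nat.cast_pos.2 (Nat.factorial_pos _)
    have hl : (l.factorial : ℝ) ≠ 0 := Nat.cast_ne_zero.2 (Nat.factorial_ne_zero _)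
    rw [harmonicNorm, div_mul_cancel₀ _ hl]
    nth_rewrite 2 [← Real.sqrt_sq hp.le]
    rw [← Real.sqrt_mul (by positivity)]
    congr 1
    field_simp
  have hsqrt' := congrArg (fun x : ℝ => (x : ℂ)) hsqrt
  have hl : (l.factorial : ℂ) ≠ 0 := Nat.cast_ne_zero.2 (Nat.factorial_ne_zero _)
  simp only [Complex.ofReal_mul, Complex.ofReal_natCast] at hsqrt'
  rw [sphericalYNonneg, iterate_derivative_legendreP_eval, hgen]
  simp only [Complex.ofReal_mul, Complex.ofReal_inv, Complex.ofReal_pow, Complex.ofReal_natCast,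
    hcoef, Complex.ofReal_ofNat]
  have e1 : ((w 0 : ℂ) + (w 1 : ℂ) * Complex.I) = u := by rw [hu]; ring
  rw [e1]
  have e2 : (-u) ^ m = (-1) ^ m * u ^ m := by rw [← mul_pow, neg_one_mul]
  rw [e2] at hkey
  generalize (quad ((w 2 : ℂ) ^ 2 - 1) (2 * (w 2 : ℂ)) 1 ^ l).coeff (l + m) = A at *
  generalize (quad (v / 2) (w 2 : ℂ) (-u / 2) ^ l).coeff (l + m) = B at *
  generalize ((Real.sqrt _ : ℝ) : ℂ) = S at *
  field_simp
  linear_combination (-1) ^ m * u ^ m * A * hsqrt' +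
    harmonicNorm l (l + m) (l - m) * l.factorial * hkey

/-- Complex conjugation exchanges the coefficients of the generating polynomial at a real point. -/
lemma conj_coeff_genPoly_pow (a : E3) (l j : ℕ) (hj : j ≤ 2 * l) :
    (starRingEnd ℂ) ((genPoly (toC3 a) ^ l).coeff j) =
      (-1) ^ (l + j) * (genPoly (toC3 a) ^ l).coeff (2 * l - j) := by
  have h1 : (genPoly (toC3 a)).map (starRingEnd ℂ) = C (-1) * quad (-(a 0 + Complex.I * a 1) / 2)
      (-(a 2 : ℂ)) ((a 0 - Complex.I * a 1) / 2) := by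
    rw [genPoly, map_quad, C_mul_quad]
    congr 1 <;> simp [toC3, map_ofNat] <;> ring
  rw [← coeff_map, Polynomial.map_pow, h1, mul_pow, ← C_pow, coeff_C_mul,
    coeff_quad_pow_neg_reverse _ _ _ _ _ hj, pow_add, mul_assoc]
  rfl

/-- At a unit vector, the spherical harmonic of degree `l` and order `n - l = l - k` is the
normalised coefficient of `X ^ n` in `genPoly w ^ l`. -/
theorem sphericalY_eq (l n k : ℕ) (h : n + k = 2 * l) (w : E3) (hw : ‖w‖ = 1) :
    sphericalY l ((n : ℤ) - l) w = (harmonicNorm l n k : ℂ) * (genPoly (toC3 w) ^ l).coeff n := by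
  rcases le_or_gt l n with hln | hln
  · obtain ⟨m, rfl⟩ := Nat.exists_eq_add_of_le hln
    obtain rfl : k = l - m := by omega
    have e : ((l + m : ℕ) : ℤ) - l = m := by push_cast; ring
    rw [e, sphericalY, if_pos (by positivity), Int.toNat_natCast,
      sphericalYNonneg_eq l m w hw]
  · obtain ⟨m, rfl⟩ := Nat.exists_eq_add_of_le hln.le
    obtain rfl : k = n + m + m := by omega
    have e : ((n : ℕ) : ℤ) - ((n + m : ℕ) : ℤ) = -m := by push_cast; ring
    rw [e, sphericalY, if_neg (by omega), Int.natAbs_neg, Int.natAbs_natCast,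
      sphericalYNonneg_eq _ m w hw, map_mul, Complex.conj_ofReal,
      conj_coeff_genPoly_pow w (n + m) (n + m + m) (by omega),
      show 2 * (n + m) - (n + m + m) = n by omega, Nat.add_sub_cancel]
    have hc : harmonicNorm (n + m) (n + m + m) n = harmonicNorm (n + m) n (n + m + m) := by
      rw [harmonicNorm, harmonicNorm, mul_comm (((n + m + m).factorial : ℕ) : ℝ)]
    have hs : (-1 : ℂ) ^ m * (-1) ^ (n + m + (n + m + m)) = 1 := by
      rw [← pow_add]
      exact Even.neg_one_pow ⟨n + m + m, by ring⟩
    rw [hc]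
    linear_combination (harmonicNorm (n + m) n (n + m + m) : ℂ) *
      (genPoly (toC3 w) ^ (n + m)).coeff n * hs

/-! ### Vector spherical harmonics as coefficients of polynomials -/

lemma norm_unitVec {x : E3} (hx : x ≠ 0) : ‖unitVec x‖ = 1 := by
  rw [unitVec, norm_smul, norm_inv, norm_norm, inv_mul_cancel₀ (norm_ne_zero_iff.2 hx)]

lemma norm_smul_toC3_unitVec {x : E3} (hx : x ≠ 0) :
    ((‖x‖ : ℝ) : ℂ) • toC3 (unitVec x) = toC3 x := by
  rw [← toC3_smul, unitVec, smul_smul, mul_inv_cancel₀ (norm_ne_zero_iff.2 hx), one_smul]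

lemma toC3_unitVec (x : E3) : toC3 (unitVec x) = ((‖x‖ : ℝ) : ℂ)⁻¹ • toC3 x := by
  rw [unitVec, toC3_smul, Complex.ofReal_inv]

/-- The standard basis vectors, as complex vectors. -/
noncomputable def basisVec (i : Fin 3) : Fin 3 → ℂ := toC3 (EuclideanSpace.single i 1)

lemma toC3_dotProduct_basisVec (a : E3) (i : Fin 3) : toC3 a ⬝ᵥ basisVec i = toC3 a i := by
  simp [basisVec, toC3_dotProduct, toC3, EuclideanSpace.inner_single_right]

lemma differentiable_coeff_genPoly_pow (l n : ℕ) :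
    Differentiable ℝ fun x : E3 => (genPoly (toC3 x) ^ l).coeff n := by
  have hc : ∀ i : Fin 3, Differentiable ℝ fun x : E3 => toC3 x i := fun i =>
    (Complex.ofRealCLM.comp (EuclideanSpace.proj i : E3 →L[ℝ] ℝ)).differentiable
  have h1 : ∀ n, Differentiable ℝ fun x : E3 => (genPoly (toC3 x)).coeff n := by
    intro n
    have h0 := hc 0
    have h1 := hc 1
    have h2 := hc 2
    have h : ∀ x : E3, (genPoly (toC3 x)).coeff n =
        (toC3 x 0 - Complex.I * toC3 x 1) / 2 * (1 : ℂ[X]).coeff n +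
          toC3 x 2 * (X : ℂ[X]).coeff n +
          -(toC3 x 0 + Complex.I * toC3 x 1) / 2 * (X ^ 2 : ℂ[X]).coeff n := by
      intro x
      simp only [genPoly, quad, coeff_add, ← coeff_C_mul, mul_one]
    simp only [h]
    fun_prop
  induction l generalizing n with
  | zero => simp
  | succ l ih =>
    simp only [pow_succ, coeff_mul]
    exact Differentiable.fun_sum fun i _ => (ih i.1).mul (h1 i.2)

lemma sphericalY_unitVec_eq (l n k : ℕ) (h : n + k = 2 * l) {x : E3} (hx : x ≠ 0) :
    sphericalY l ((n : ℤ) - l) (unitVec x) =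
      (harmonicNorm l n k : ℂ) * (((‖x‖⁻¹ : ℝ) : ℂ) ^ l * (genPoly (toC3 x) ^ l).coeff n) := by
  rw [sphericalY_eq l n k h _ (norm_unitVec hx), toC3_unitVec, coeff_genPoly_smul_pow,
    Complex.ofReal_inv]

lemma hasDerivAt_inv_norm_pow (w e : E3) (hw : ‖w‖ = 1) (l : ℕ) :
    HasDerivAt (fun t : ℝ => (((‖w + t • e‖⁻¹ : ℝ) : ℂ) ^ l)) (-(l * (inner ℝ w e : ℝ))) 0 := by
  have h1 : HasDerivAt (fun t : ℝ => w + t • e) e 0 := by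
    simpa using ((hasDerivAt_id (0 : ℝ)).smul_const e).const_add w
  have h2 := h1.norm_sq.sqrt (by simp [hw])
  simp only [Real.sqrt_sq (norm_nonneg _), zero_smul, add_zero, hw] at h2
  have h3 := ((h2.fun_inv (by simp [hw])).fun_pow l).ofReal_comp
  simp only [Complex.ofReal_pow] at h3
  refine h3.congr_deriv ?_
  simp [hw]

/-- The surface gradient of a spherical harmonic: the gradient of the solid harmonic, from which
the radial component is removed. -/
lemma surfaceGradient_sphericalY (l n k : ℕ) (h : n + k = 2 * l) (w : E3) (hw : ‖w‖ = 1)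
    (i : Fin 3) :
    surfaceGradient (sphericalY l ((n : ℤ) - l)) w i = (harmonicNorm l n k : ℂ) *
      (l * (genPoly (toC3 w) ^ (l - 1) * genPoly (basisVec i)).coeff n -
        l * toC3 w i * (genPoly (toC3 w) ^ l).coeff n) := by
  have hw0 : w ≠ 0 := by
    rintro rfl
    simp at hw
  set g : E3 → ℂ := fun x =>
    (harmonicNorm l n k : ℂ) * (((‖x‖⁻¹ : ℝ) : ℂ) ^ l * (genPoly (toC3 x) ^ l).coeff n) with hg
  have heq : (fun x : E3 => sphericalY l ((n : ℤ) - l) (unitVec x)) =ᶠ[nhds w] g := by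
    filter_upwards [isOpen_ne.mem_nhds hw0] with x hx using sphericalY_unitVec_eq l n k h hx
  have hdiff : DifferentiableAt ℝ g w := by
    have h1 : DifferentiableAt ℝ (fun x : E3 => ((‖x‖⁻¹ : ℝ) : ℂ)) w :=
      Complex.ofRealCLM.differentiableAt.comp w
        ((differentiableAt_id.norm ℝ hw0).inv (norm_ne_zero_iff.2 hw0))
    exact ((h1.pow l).mul (differentiable_coeff_genPoly_pow l n w)).const_mul _
  rw [surfaceGradient, heq.fderiv_eq, ← hdiff.lineDeriv_eq_fderiv, lineDeriv]
  have h1 := hasDerivAt_inv_norm_pow w (EuclideanSpace.single i 1) hw l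
  have h2 := (hasDerivAt_coeff_genPoly_pow (toC3 w) (basisVec i) l n ((0 : ℝ) : ℂ)).comp_ofReal
  have h3 := (h1.mul h2).const_mul (harmonicNorm l n k : ℂ)
  have h4 : (fun t : ℝ => g (w + t • EuclideanSpace.single i 1)) = fun t : ℝ =>
      (harmonicNorm l n k : ℂ) * (((‖w + t • EuclideanSpace.single i (1 : ℝ)‖⁻¹ : ℝ) : ℂ) ^ l *
        (genPoly (toC3 w + (t : ℂ) • basisVec i) ^ l).coeff n) := by
    funext t
    rw [hg, basisVec, ← toC3_smul, ← toC3_add]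
  rw [h4]
  refine h3.deriv.trans ?_
  have h5 : ((inner ℝ w (EuclideanSpace.single i (1 : ℝ)) : ℝ) : ℂ) = toC3 w i := by
    rw [← toC3_dotProduct_basisVec, basisVec, toC3_dotProduct]
  rw [h5]
  simp only [Complex.ofReal_zero, zero_smul, add_zero, hw, inv_one, Complex.ofReal_one, one_pow]
  ring

lemma vectorW_eq (l n k : ℕ) (h : n + k = 2 * l) (w : E3) (hw : ‖w‖ = 1) (i : Fin 3) :
    vectorW l ((n : ℤ) - l) w i = (harmonicNorm l n k : ℂ) *
      (l * (genPoly (toC3 w) ^ (l - 1) * genPoly (basisVec i)).coeff n) := by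
  rw [vectorW, Pi.add_apply, Pi.smul_apply, surfaceGradient_sphericalY l n k h w hw,
    sphericalY_eq l n k h w hw, smul_eq_mul]
  ring

lemma vectorV_eq (l n k : ℕ) (h : n + k = 2 * l) (w : E3) (hw : ‖w‖ = 1) (i : Fin 3) :
    vectorV l ((n : ℤ) - l) w i = (harmonicNorm l n k : ℂ) *
      (l * (genPoly (toC3 w) ^ (l - 1) * genPoly (basisVec i)).coeff n -
        (2 * l + 1) * toC3 w i * (genPoly (toC3 w) ^ l).coeff n) := by
  rw [vectorV, Pi.sub_apply, Pi.smul_apply, surfaceGradient_sphericalY l n k h w hw,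
    sphericalY_eq l n k h w hw, smul_eq_mul]
  ring

/-- The rescaled `W_l^m` is, up to a constant, the gradient of a regular solid harmonic. -/
lemma norm_zpow_smul_vectorW (l n k : ℕ) (h : n + k = 2 * l) {x : E3} (hx : x ≠ 0) (i : Fin 3) :
    ((‖x‖ ^ ((l : ℤ) - 1) : ℝ) : ℂ) * vectorW l ((n : ℤ) - l) (unitVec x) i =
      (harmonicNorm l n k : ℂ) *
        (l * (genPoly (toC3 x) ^ (l - 1) * genPoly (basisVec i)).coeff n) := by
  rw [vectorW_eq l n k h _ (norm_unitVec hx)]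
  cases l with
  | zero => simp
  | succ l =>
    have hx' : ((‖x‖ : ℝ) : ℂ) ≠ 0 := Complex.ofReal_ne_zero.2 (norm_ne_zero_iff.2 hx)
    rw [toC3_unitVec, coeff_genPoly_smul_pow_mul]
    have e : (((l + 1 : ℕ) : ℤ) - 1) = (l : ℤ) := by push_cast; ring
    rw [e, zpow_natCast, Nat.add_sub_cancel, Complex.ofReal_pow, inv_pow]
    field_simp

/-- The rescaled `V_l^m` is, up to a constant, the gradient of an irregular solid harmonic. -/
lemma norm_zpow_smul_vectorV (l n k : ℕ) (h : n + k = 2 * l) {x : E3} (hx : x ≠ 0) (i : Fin 3) :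
    ((‖x‖ ^ (-(l : ℤ) - 2) : ℝ) : ℂ) * vectorV l ((n : ℤ) - l) (unitVec x) i =
      (harmonicNorm l n k : ℂ) * (l.factorial / (n.factorial * k.factorial)) *
        ∑ j ∈ Finset.range 3, (dualPoly (basisVec i)).coeff j *
          irregular (l + 1) (n + j) (toC3 x) ((‖x‖ : ℝ) : ℂ)⁻¹ := by
  have hx' : ((‖x‖ : ℝ) : ℂ) ≠ 0 := Complex.ofReal_ne_zero.2 (norm_ne_zero_iff.2 hx)
  have hn : (n.factorial : ℂ) ≠ 0 := Nat.cast_ne_zero.2 (Nat.factorial_ne_zero _)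
  have hk : (k.factorial : ℂ) ≠ 0 := Nat.cast_ne_zero.2 (Nat.factorial_ne_zero _)
  have hl : (l.factorial : ℂ) ≠ 0 := Nat.cast_ne_zero.2 (Nat.factorial_ne_zero _)
  have hs : ((‖x‖ : ℝ) : ℂ)⁻¹ ^ 2 * (toC3 x ⬝ᵥ toC3 x) = 1 := by
    rw [toC3_dotProduct_self, Complex.ofReal_pow, ← mul_pow, inv_mul_cancel₀ hx', one_pow]
  have hz : ((‖x‖ ^ (-(l : ℤ) - 2) : ℝ) : ℂ) = ((‖x‖ : ℝ) : ℂ)⁻¹ ^ (l + 2) := by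
    have e : (-(l : ℤ) - 2) = -((l + 2 : ℕ) : ℤ) := by push_cast; ring
    rw [e, zpow_neg, zpow_natCast, Complex.ofReal_inv, Complex.ofReal_pow, inv_pow]
  rw [← irregular_directional l n (by omega) _ _ _ hs, toC3_dotProduct_basisVec,
    vectorV_eq l n k h _ (norm_unitVec hx), hz, show 2 * l - n = k by omega, toC3_unitVec,
    coeff_genPoly_smul_pow, Pi.smul_apply, smul_eq_mul]
  generalize ((‖x‖ : ℝ) : ℂ)⁻¹ = s
  have hW : (l : ℂ) * (genPoly (s • toC3 x) ^ (l - 1) * genPoly (basisVec i)).coeff n * s =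
      s ^ l * (l * (genPoly (toC3 x) ^ (l - 1) * genPoly (basisVec i)).coeff n) := by
    cases l with
    | zero => simp
    | succ l =>
      rw [coeff_genPoly_smul_pow_mul, Nat.add_sub_cancel]
      ring
  field_simp
  linear_combination (harmonicNorm l n k : ℂ) * s ^ (l + 1) * hW

/-! ### The addition theorems -/

lemma binom_natCast (n k : ℕ) : binom (n : ℤ) (k : ℤ) = n.choose k := by
  simp [binom]

/-- Summation over the orders `μ = i - N`, `0 ≤ i ≤ 2 N`. -/
lemma sum_Icc_neg_eq {M : Type*} [AddCommMonoid M] (N : ℕ) (f : ℤ → M) :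
    ∑ μ ∈ Finset.Icc (-(N : ℤ)) (N : ℤ), f μ =
      ∑ i ∈ Finset.range (2 * N + 1), f ((i : ℤ) - N) := by
  refine Finset.sum_nbij' (fun μ => (μ + N).toNat) (fun i => (i : ℤ) - N) ?_ ?_ ?_ ?_ ?_
  · intro μ hμ
    rw [Finset.mem_Icc] at hμ
    rw [Finset.mem_range]
    omega
  · intro i hi
    rw [Finset.mem_range] at hi
    rw [Finset.mem_Icc]
    omega
  · intro μ hμ
    rw [Finset.mem_Icc] at hμ
    omega
  · intro i hi
    simp
  · intro μ hμ
    rw [Finset.mem_Icc] at hμ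
    congr 1
    omega

/-- The factor in `solidR` and `solidI` turns `harmonicNorm` into a square root of factorials. -/
lemma sqrt_mul_harmonicNorm (l n k : ℕ) :
    Real.sqrt (4 * Real.pi / (2 * (l : ℝ) + 1)) * harmonicNorm l n k =
      Real.sqrt (n.factorial * k.factorial) / l.factorial := by
  rw [harmonicNorm, ← mul_div_assoc, ← Real.sqrt_mul (by positivity)]
  congr 2
  have := Real.pi_pos
  field_simp

lemma solidR_eq (l n k : ℕ) (h : n + k = 2 * l) {a : E3} (ha : a ≠ 0) :
    solidR l ((n : ℤ) - l) a =
      ((Real.sqrt (n.factorial * k.factorial) / l.factorial : ℝ) : ℂ) *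
        (genPoly (toC3 a) ^ l).coeff n := by
  rw [solidR, sphericalY_unitVec_eq l n k h ha, ← sqrt_mul_harmonicNorm]
  have hs : (((‖a‖ ^ l : ℝ)) : ℂ) * ((‖a‖⁻¹ : ℝ) : ℂ) ^ l = 1 := by
    rw [← Complex.ofReal_pow, ← Complex.ofReal_mul, ← mul_pow,
      mul_inv_cancel₀ (norm_ne_zero_iff.2 ha), one_pow, Complex.ofReal_one]
  rw [Complex.ofReal_mul]
  linear_combination ((Real.sqrt (4 * Real.pi / (2 * (l : ℝ) + 1)) : ℝ) : ℂ) *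
    (harmonicNorm l n k : ℂ) * (genPoly (toC3 a) ^ l).coeff n * hs

lemma solidI_eq (l n k : ℕ) (h : n + k = 2 * l) {a : E3} (ha : a ≠ 0) :
    solidI l ((n : ℤ) - l) a =
      ((Real.sqrt (n.factorial * k.factorial) : ℝ) : ℂ)⁻¹ *
        irregular l n (toC3 a) ((‖a‖ : ℝ) : ℂ)⁻¹ := by
  have ha' : ((‖a‖ : ℝ) : ℂ) ≠ 0 := Complex.ofReal_ne_zero.2 (norm_ne_zero_iff.2 ha)
  have hS : (0 : ℝ) < n.factorial * k.factorial := by positivity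
  have hS' : ((Real.sqrt (n.factorial * k.factorial) : ℝ) : ℂ) ≠ 0 :=
    Complex.ofReal_ne_zero.2 (Real.sqrt_pos.2 hS).ne'
  have hS2 : ((Real.sqrt (n.factorial * k.factorial) : ℝ) : ℂ) ^ 2 =
      n.factorial * k.factorial := by
    rw [← Complex.ofReal_pow, Real.sq_sqrt hS.le]
    push_cast
    rfl
  have hc := congrArg (fun x : ℝ => (x : ℂ)) (sqrt_mul_harmonicNorm l n k)
  simp only [Complex.ofReal_mul, Complex.ofReal_div, Complex.ofReal_natCast] at hc hS' hS2
  have hl : (l.factorial : ℂ) ≠ 0 := Nat.cast_ne_zero.2 (Nat.factorial_ne_zero _)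
  rw [solidI, sphericalY_unitVec_eq l n k h ha, irregular, show 2 * l - n = k by omega]
  rw [← hS2, mul_div_assoc (harmonicNorm l n k : ℂ), ← mul_assoc, hc]
  push_cast
  rw [inv_pow, inv_pow]
  field_simp
  ring

/-- The constant in the irregular addition theorem. -/
lemma irregular_constant (l n k ν i j : ℕ) (hν : ν ≠ 0) :
    Real.sqrt ((2 * (l : ℝ) + 1) / (2 * (ν : ℝ) + 1)) *
      Real.sqrt ((k + i).choose i * (n + j).choose j) *
      (Real.sqrt ((n + j).factorial * (k + i).factorial))⁻¹ * (harmonicNorm ν i j * ν) =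
    harmonicNorm l n k * (l.factorial / (n.factorial * k.factorial)) *
      ((ν - 1).factorial : ℝ)⁻¹ := by
  have f : ∀ x : ℕ, (x.factorial : ℝ) ≠ 0 := fun x => Nat.cast_ne_zero.2 x.factorial_ne_zero
  have c1 : ((k + i).choose i : ℝ) = (k + i).factorial / (i.factorial * k.factorial) := by
    rw [add_comm k i, Nat.cast_add_choose]
  have c2 : ((n + j).choose j : ℝ) = (n + j).factorial / (j.factorial * n.factorial) := by
    rw [add_comm n j, Nat.cast_add_choose]
  have c3 : (ν.factorial : ℝ) = ν * (ν - 1).factorial := by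
    exact_mod_cast (Nat.mul_factorial_pred hν).symm
  have hν' : (ν : ℝ) ≠ 0 := Nat.cast_ne_zero.2 hν
  have hpi := Real.pi_pos
  have f1 := f (n + j)
  have f2 := f (k + i)
  have f3 := f (ν - 1)
  rw [← sq_eq_sq₀ (by unfold harmonicNorm; positivity) (by unfold harmonicNorm; positivity)]
  simp only [harmonicNorm, mul_pow, div_pow, inv_pow]
  repeat rw [Real.sq_sqrt (by positivity)]
  rw [c1, c2, c3]
  field_simp

/-- The constant in the regular addition theorem. -/
lemma regular_constant (i j n k ν κ : ℕ) :
    Real.sqrt ((2 * ((ν + κ : ℕ) : ℝ) + 1) / (2 * (ν : ℝ) + 1)) *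
      (Real.sqrt (n.factorial * k.factorial) / κ.factorial) *
      Real.sqrt ((i + n).choose i * (j + k).choose j) * harmonicNorm ν i j =
    harmonicNorm (ν + κ) (i + n) (j + k) * (ν + κ).choose ν := by
  have f : ∀ x : ℕ, (x.factorial : ℝ) ≠ 0 := fun x => Nat.cast_ne_zero.2 x.factorial_ne_zero
  have hpi := Real.pi_pos
  have f1 := f (i + n)
  have f2 := f (j + k)
  have f3 := f (ν + κ)
  rw [← sq_eq_sq₀ (by unfold harmonicNorm; positivity) (by unfold harmonicNorm; positivity)]
  simp only [harmonicNorm, mul_pow, div_pow]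
  repeat rw [Real.sq_sqrt (by positivity)]
  simp only [Nat.cast_add_choose]
  field_simp

/-- The derivative of the binomial formula for `(P + R) ^ l` in the direction `E`. -/
lemma derivative_add_pow {A : Type*} [CommRing A] (P R E : A) (l : ℕ) :
    (l : A) * ((P + R) ^ (l - 1) * E) = ∑ ν ∈ Finset.range (l + 1),
      (l.choose ν : A) * ((ν : A) * (P ^ (ν - 1) * E) * R ^ (l - ν)) := by
  cases l with
  | zero => simp
  | succ l =>
    rw [Finset.sum_range_succ', Nat.add_sub_cancel, add_pow, Finset.sum_mul, Finset.mul_sum]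
    simp only [Nat.cast_zero, zero_mul, mul_zero, add_zero]
    refine Finset.sum_congr rfl fun ν _ => ?_
    have h : ((l + 1 : ℕ) : A) * (l.choose ν : A) =
        ((l + 1).choose (ν + 1) : A) * ((ν + 1 : ℕ) : A) := by
      exact_mod_cast congrArg (Nat.cast : ℕ → A) (Nat.add_one_mul_choose_eq l ν)
    rw [Nat.add_sub_cancel, Nat.add_sub_add_right]
    linear_combination P ^ ν * R ^ (l - ν) * E * h

lemma coeff_mul_eq_sum_range {A : Type*} [CommRing A] (p q : A[X]) (N n : ℕ)
    (hp : p.natDegree ≤ N) :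
    (p * q).coeff n =
      ∑ i ∈ Finset.range (N + 1), if i ≤ n then p.coeff i * q.coeff (n - i) else 0 := by
  conv_lhs => rw [p.as_sum_range' (N + 1) (Nat.lt_succ_of_le hp), Finset.sum_mul, finsetSum_coeff]
  refine Finset.sum_congr rfl fun i _ => ?_
  rw [← C_mul_X_pow_eq_monomial, mul_assoc, coeff_C_mul, coeff_X_pow_mul']
  split_ifs <;> simp

/-- One term of the regular addition theorem; the order is `μ = i - ν`, and `j = ν - μ`. -/
lemma regular_term (l n k ν i j : ℕ) (hnk : n + k = 2 * l) (hν : ν ≤ l) (hij : i + j = 2 * ν)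
    {r a : E3} (hr : r ≠ 0) (ha : a ≠ 0) (x : Fin 3) :
    (((Real.sqrt ((2 * (l : ℝ) + 1) / (2 * (ν : ℝ) + 1)) : ℝ) : ℂ) *
        ((‖r‖ ^ ((ν : ℤ) - 1) : ℝ) : ℂ) *
        solidR (l - ν) (((n : ℤ) - l) - ((i : ℤ) - ν)) a *
        ((Real.sqrt (binom (l + ((n : ℤ) - l)) (ν + ((i : ℤ) - ν)) *
          binom (l - ((n : ℤ) - l)) (ν - ((i : ℤ) - ν))) : ℝ) : ℂ)) *
        vectorW ν ((i : ℤ) - ν) (unitVec r) x =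
      if i ≤ n then (harmonicNorm l n k : ℂ) * ((l.choose ν : ℂ) *
        (ν * (genPoly (toC3 r) ^ (ν - 1) * genPoly (basisVec x)).coeff i *
          (genPoly (toC3 a) ^ (l - ν)).coeff (n - i))) else 0 := by
  have e1 : (l : ℤ) + ((n : ℤ) - l) = (n : ℕ) := by ring
  have e2 : (ν : ℤ) + ((i : ℤ) - ν) = (i : ℕ) := by ring
  have e3 : (l : ℤ) - ((n : ℤ) - l) = (k : ℕ) := by omega
  have e4 : (ν : ℤ) - ((i : ℤ) - ν) = (j : ℕ) := by omega
  have hW := norm_zpow_smul_vectorW ν i j hij hr x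
  rw [e1, e2, e3, e4, binom_natCast, binom_natCast]
  rcases le_or_gt i n with hin | hin
  · rw [if_pos hin]
    obtain ⟨n, rfl⟩ := Nat.exists_eq_add_of_le hin
    obtain ⟨κ, rfl⟩ := Nat.exists_eq_add_of_le hν
    rcases le_or_gt j k with hjk | hjk
    · obtain ⟨k, rfl⟩ := Nat.exists_eq_add_of_le hjk
      have e5 : (((i + n : ℕ) : ℤ) - ((ν + κ : ℕ) : ℤ)) - ((i : ℤ) - ν) = (n : ℤ) - κ := by
        push_cast
        ring
      have hc := congrArg (fun x : ℝ => (x : ℂ)) (regular_constant i j n k ν κ)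
      simp only [Complex.ofReal_mul, Complex.ofReal_natCast] at hc
      rw [e5, Nat.add_sub_cancel_left, Nat.add_sub_cancel_left,
        solidR_eq κ n k (by omega) ha]
      linear_combination ((Real.sqrt ((2 * ((ν + κ : ℕ) : ℝ) + 1) / (2 * (ν : ℝ) + 1)) : ℝ) : ℂ) *
        ((Real.sqrt (n.factorial * k.factorial) / κ.factorial : ℝ) : ℂ) *
        (genPoly (toC3 a) ^ κ).coeff n *
        ((Real.sqrt ((i + n).choose i * (j + k).choose j) : ℝ) : ℂ) * hW +
        (genPoly (toC3 a) ^ κ).coeff n *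
        (ν * (genPoly (toC3 r) ^ (ν - 1) * genPoly (basisVec x)).coeff i) * hc
    -- the order `m - μ` exceeds the degree `l - ν`: the binomial coefficient and the coefficient of
    -- `genPoly` both vanish, whatever `solidR` is
    · have h0 : (genPoly (toC3 a) ^ κ).coeff n = 0 :=
        coeff_eq_zero_of_natDegree_lt ((natDegree_genPoly_pow_le _ κ).trans_lt (by omega))
      rw [Nat.add_sub_cancel_left, Nat.add_sub_cancel_left, h0, Nat.choose_eq_zero_of_lt hjk]
      simp
  · rw [if_neg (by omega), Nat.choose_eq_zero_of_lt hin]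
    simp

/-- One term of the irregular addition theorem; the order is `μ = i - ν`, and `j = ν - μ`. -/
lemma irregular_term (l n k ν i j : ℕ) (hnk : n + k = 2 * l) (hν : ν ≠ 0) (hij : i + j = 2 * ν)
    {r a : E3} (hr : r ≠ 0) (ha : a ≠ 0) (x : Fin 3) :
    ((-1 : ℂ) ^ ((ν : ℤ) + ((i : ℤ) - ν)) *
        ((Real.sqrt ((2 * (l : ℝ) + 1) / (2 * (ν : ℝ) + 1)) : ℝ) : ℂ) *
        ((‖r‖ ^ ((ν : ℤ) - 1) : ℝ) : ℂ) *
        solidI (l + ν) (((n : ℤ) - l) - ((i : ℤ) - ν)) a *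
        ((Real.sqrt (binom (l + ν + ((i : ℤ) - ν) - ((n : ℤ) - l)) (ν + ((i : ℤ) - ν)) *
          binom (l + ν + ((n : ℤ) - l) - ((i : ℤ) - ν)) (ν - ((i : ℤ) - ν))) : ℝ) : ℂ)) *
        vectorW ν ((i : ℤ) - ν) (unitVec r) x =
      (harmonicNorm l n k : ℂ) * (l.factorial / (n.factorial * k.factorial)) *
        (((ν - 1).factorial : ℂ)⁻¹ *
          ((dualPoly (toC3 r) ^ (ν - 1) * dualPoly (basisVec x)).coeff j *
            irregular (l + ν) (n + j) (toC3 a) ((‖a‖ : ℝ) : ℂ)⁻¹)) := by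
  have e2 : (ν : ℤ) + ((i : ℤ) - ν) = (i : ℕ) := by ring
  have e3 : (l : ℤ) + ν + ((i : ℤ) - ν) - ((n : ℤ) - l) = ((k + i : ℕ) : ℤ) := by omega
  have e4 : (l : ℤ) + ν + ((n : ℤ) - l) - ((i : ℤ) - ν) = ((n + j : ℕ) : ℤ) := by omega
  have e5 : (ν : ℤ) - ((i : ℤ) - ν) = (j : ℕ) := by omega
  have e6 : ((n : ℤ) - l) - ((i : ℤ) - ν) = ((n + j : ℕ) : ℤ) - ((l + ν : ℕ) : ℤ) := by omega
  have hW := norm_zpow_smul_vectorW ν i j hij hr x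
  have hc := congrArg (fun x : ℝ => (x : ℂ)) (irregular_constant l n k ν i j hν)
  simp only [Complex.ofReal_mul, Complex.ofReal_natCast, Complex.ofReal_inv,
    Complex.ofReal_div] at hc
  have hsign : (-1 : ℂ) ^ j = (-1) ^ i := by
    have h : (-1 : ℂ) ^ i * (-1) ^ i = 1 := by rw [← mul_pow]; simp
    have h' : (-1 : ℂ) ^ i * (-1) ^ j = 1 := by
      rw [← pow_add, hij, pow_mul]
      simp
    linear_combination (-1 : ℂ) ^ i * h' - (-1) ^ j * h
  rw [e2, e3, e4, e5, e6, binom_natCast, binom_natCast, zpow_natCast,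
    solidI_eq (l + ν) (n + j) (k + i) (by omega) ha,
    coeff_dualPoly_pow_mul _ _ _ _ (by omega), show 2 * (ν - 1) + 2 - j = i by omega, hsign]
  linear_combination (-1) ^ i *
    ((Real.sqrt ((2 * (l : ℝ) + 1) / (2 * (ν : ℝ) + 1)) : ℝ) : ℂ) *
    ((Real.sqrt ((n + j).factorial * (k + i).factorial) : ℝ) : ℂ)⁻¹ *
    irregular (l + ν) (n + j) (toC3 a) ((‖a‖ : ℝ) : ℂ)⁻¹ *
    ((Real.sqrt ((k + i).choose i * (n + j).choose j) : ℝ) : ℂ) * hW +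
    (-1) ^ i * irregular (l + ν) (n + j) (toC3 a) ((‖a‖ : ℝ) : ℂ)⁻¹ *
    (genPoly (toC3 r) ^ (ν - 1) * genPoly (basisVec x)).coeff i * hc

lemma toC3_cross_vectorW (l : ℕ) (m : ℤ) (w : E3) :
    toC3 w ⨯₃ vectorW l m w = vectorX l m w := by
  rw [vectorW, vectorX, map_add, map_smul, cross_self, smul_zero, add_zero]

lemma toC3_cross_vectorV (l : ℕ) (m : ℤ) (w : E3) :
    toC3 w ⨯₃ vectorV l m w = vectorX l m w := by
  rw [vectorV, vectorX, map_sub, map_smul, cross_self, smul_zero, sub_zero]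

lemma exists_orders {l : ℕ} {m : ℤ} (hm : |m| ≤ (l : ℤ)) :
    ∃ n k : ℕ, n + k = 2 * l ∧ m = (n : ℤ) - l := by
  rw [abs_le] at hm
  exact ⟨(l + m).toNat, (l - m).toNat, by omega, by omega⟩

lemma add_ne_zero_of_norm_lt {r a : E3} (ha : ‖r‖ < ‖a‖) : r + a ≠ 0 := by
  intro h
  rw [eq_neg_of_add_eq_zero_left h, norm_neg] at ha
  exact lt_irrefl _ ha

/-- The addition theorem for `V_l^m`: the addition theorem for irregular solid harmonics, applied
to the components of the gradient of an irregular solid harmonic. -/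
theorem hasSum_vectorV (l : ℕ) (m : ℤ) (hm : |m| ≤ (l : ℤ)) (r a : E3) (hr : r ≠ 0)
    (ha : ‖r‖ < ‖a‖) :
    HasSum
      (fun ν : ℕ+ => ∑ μ ∈ Finset.Icc (-(ν : ℤ)) (ν : ℤ),
        ((-1 : ℂ) ^ ((ν : ℤ) + μ) *
          ((Real.sqrt ((2 * (l : ℝ) + 1) / (2 * (ν : ℝ) + 1)) : ℝ) : ℂ) *
          ((‖r‖ ^ ((ν : ℤ) - 1) : ℝ) : ℂ) *
          solidI (l + ν) (m - μ) a *
          ((Real.sqrt (binom (l + ν + μ - m) (ν + μ) * binom (l + ν + m - μ) (ν - μ)) : ℝ) : ℂ)) •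
        vectorW ν μ (unitVec r))
      (((‖r + a‖ ^ (-(l : ℤ) - 2) : ℝ) : ℂ) • vectorV l m (unitVec (r + a))) := by
  obtain ⟨n, k, hnk, rfl⟩ := exists_orders hm
  have ha0 : a ≠ 0 := norm_pos_iff.1 ((norm_nonneg r).trans_lt ha)
  rw [Pi.hasSum]
  intro x
  rw [Pi.smul_apply, smul_eq_mul,
    norm_zpow_smul_vectorV l n k hnk (add_ne_zero_of_norm_lt ha) x,
    ← Equiv.pnatEquivNat.symm.hasSum_iff]
  have h := (hasSum_irregular a r hr ha (l + 1) n 2 (dualPoly (basisVec x))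
    (natDegree_quad_le _ _ _) (by omega)).mul_left
    ((harmonicNorm l n k : ℂ) * (l.factorial / (n.factorial * k.factorial)))
  refine h.congr_fun fun κ => ?_
  have hν : ((Equiv.pnatEquivNat.symm κ : ℕ+) : ℕ) = κ + 1 := rfl
  simp only [Function.comp_apply, hν]
  rw [sum_Icc_neg_eq, Finset.sum_apply, ← Finset.sum_range_reflect, Finset.mul_sum, Finset.mul_sum]
  refine Finset.sum_congr (by congr 1; ring) fun j hj => ?_
  have hj' := Finset.mem_range.1 hj
  have hi : 2 * (κ + 1) + 1 - 1 - j + j = 2 * (κ + 1) := by omega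
  rw [Pi.smul_apply, smul_eq_mul,
    irregular_term l n k (κ + 1) _ j hnk κ.succ_ne_zero hi hr ha0 x, Nat.add_sub_cancel,
    mul_comm (dualPoly (basisVec x)), add_assoc l 1 κ, add_comm 1 κ]

/-- The addition theorem for `W_l^m`: the binomial formula for powers of the generating polynomial,
differentiated in the directions of the coordinate axes. -/
theorem vectorW_addition (l : ℕ) (m : ℤ) (hm : |m| ≤ (l : ℤ)) (r a : E3) (hr : r ≠ 0)
    (ha : ‖r‖ < ‖a‖) :
    ((‖r + a‖ ^ ((l : ℤ) - 1) : ℝ) : ℂ) • vectorW l m (unitVec (r + a)) =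
      ∑ ν ∈ Finset.range (l + 1), ∑ μ ∈ Finset.Icc (-(ν : ℤ)) (ν : ℤ),
        (((Real.sqrt ((2 * (l : ℝ) + 1) / (2 * (ν : ℝ) + 1)) : ℝ) : ℂ) *
          ((‖r‖ ^ ((ν : ℤ) - 1) : ℝ) : ℂ) *
          solidR (l - ν) (m - μ) a *
          ((Real.sqrt (binom (l + m) (ν + μ) * binom (l - m) (ν - μ)) : ℝ) : ℂ)) •
        vectorW ν μ (unitVec r) := by
  obtain ⟨n, k, hnk, rfl⟩ := exists_orders hm
  have ha0 : a ≠ 0 := norm_pos_iff.1 ((norm_nonneg r).trans_lt ha)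
  ext x
  rw [Pi.smul_apply, smul_eq_mul,
    norm_zpow_smul_vectorW l n k hnk (add_ne_zero_of_norm_lt ha) x, toC3_add, genPoly_add,
    ← coeff_natCast_mul, derivative_add_pow, finsetSum_coeff, Finset.mul_sum, Finset.sum_apply]
  refine Finset.sum_congr rfl fun ν hν => ?_
  have hνl : ν ≤ l := Nat.lt_succ_iff.1 (Finset.mem_range.1 hν)
  have hdeg : ((ν : ℂ[X]) * (genPoly (toC3 r) ^ (ν - 1) * genPoly (basisVec x))).natDegree ≤
      2 * ν := by
    cases ν with
    | zero => simp
    | succ ν =>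
      rw [← C_eq_natCast]
      refine (natDegree_C_mul_le _ _).trans ?_
      exact natDegree_genPoly_pow_mul_le _ _ ν
  rw [sum_Icc_neg_eq, Finset.sum_apply, coeff_natCast_mul, coeff_mul_eq_sum_range _ _ _ _ hdeg,
    Finset.mul_sum, Finset.mul_sum]
  refine Finset.sum_congr rfl fun i hi => ?_
  have hi' := Finset.mem_range.1 hi
  rw [Pi.smul_apply, smul_eq_mul,
    regular_term l n k ν i (2 * ν - i) hnk hνl (by omega) hr ha0 x, coeff_natCast_mul]
  split_ifs <;> simp

end VectorHarmonics

open VectorHarmonics in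
theorem mainTheorem1 (l : ℕ) (m : ℤ) (hm : |m| ≤ (l : ℤ)) (r a : EuclideanSpace ℝ (Fin 3))
    (hr : r ≠ 0) (ha : ‖r‖ < ‖a‖) :
    HasSum
      (fun ν : ℕ+ => ∑ μ ∈ Finset.Icc (-(ν : ℤ)) (ν : ℤ),
        ((-1 : ℂ) ^ ((ν : ℤ) + μ) *
          ((Real.sqrt ((2 * (l : ℝ) + 1) / (2 * (ν : ℝ) + 1)) : ℝ) : ℂ) *
          ((‖r‖ ^ ((ν : ℤ) - 1) : ℝ) : ℂ) *
          solidI (l + ν) (m - μ) a *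
          ((Real.sqrt (binom (l + ν + μ - m) (ν + μ) * binom (l + ν + m - μ) (ν - μ)) : ℝ) : ℂ)) •
        vectorW ν μ (unitVec r))
      (((‖r + a‖ ^ (-(l : ℤ) - 2) : ℝ) : ℂ) • vectorV l m (unitVec (r + a)))
    ∧
    ((‖r + a‖ ^ ((l : ℤ) - 1) : ℝ) : ℂ) • vectorW l m (unitVec (r + a)) =
      ∑ ν ∈ Finset.range (l + 1), ∑ μ ∈ Finset.Icc (-(ν : ℤ)) (ν : ℤ),
        (((Real.sqrt ((2 * (l : ℝ) + 1) / (2 * (ν : ℝ) + 1)) : ℝ) : ℂ) *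
          ((‖r‖ ^ ((ν : ℤ) - 1) : ℝ) : ℂ) *
          solidR (l - ν) (m - μ) a *
          ((Real.sqrt (binom (l + m) (ν + μ) * binom (l - m) (ν - μ)) : ℝ) : ℂ)) •
        vectorW ν μ (unitVec r)
    ∧
    HasSum
      (fun ν : ℕ+ => ∑ μ ∈ Finset.Icc (-(ν : ℤ)) (ν : ℤ),
        ((-1 : ℂ) ^ ((ν : ℤ) + μ) *
          ((Real.sqrt ((2 * (l : ℝ) + 1) / (2 * (ν : ℝ) + 1)) : ℝ) : ℂ) *
          ((‖r‖ ^ ((ν : ℤ) - 1) : ℝ) : ℂ) *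
          solidI (l + ν) (m - μ) a *
          ((Real.sqrt (binom (l + ν + μ - m) (ν + μ) * binom (l + ν + m - μ) (ν - μ)) : ℝ) : ℂ)) •
        ((‖r‖ : ℂ) • vectorX ν μ (unitVec r) + toC3 a ⨯₃ vectorW ν μ (unitVec r)))
      (((‖r + a‖ ^ (-(l : ℤ) - 1) : ℝ) : ℂ) • vectorX l m (unitVec (r + a))) := by
  have hV := hasSum_vectorV l m hm r a hr ha
  refine ⟨hV, vectorW_addition l m hm r a hr ha, ?_⟩
  have hra := add_ne_zero_of_norm_lt ha
  -- the third expansion is the cross product of `r + a` with the first one, since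
  -- `r̂ × W = X` and `r̂' × V = X`
  have h := hV.map (crossProduct (toC3 (r + a)))
    (LinearMap.continuous_of_finiteDimensional _)
  have hterm : ∀ (ν : ℕ) (μ : ℤ), toC3 (r + a) ⨯₃ vectorW ν μ (unitVec r) =
      (‖r‖ : ℂ) • vectorX ν μ (unitVec r) + toC3 a ⨯₃ vectorW ν μ (unitVec r) := by
    intro ν μ
    rw [toC3_add, map_add, LinearMap.add_apply, ← norm_smul_toC3_unitVec hr, map_smul,
      LinearMap.smul_apply, toC3_cross_vectorW]
  have hval : toC3 (r + a) ⨯₃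
      (((‖r + a‖ ^ (-(l : ℤ) - 2) : ℝ) : ℂ) • vectorV l m (unitVec (r + a))) =
      ((‖r + a‖ ^ (-(l : ℤ) - 1) : ℝ) : ℂ) • vectorX l m (unitVec (r + a)) := by
    have e : (-(l : ℤ) - 1) = -(l : ℤ) - 2 + 1 := by ring
    rw [← norm_smul_toC3_unitVec hra, map_smul, map_smul, LinearMap.smul_apply,
      toC3_cross_vectorV, smul_smul, e, zpow_add_one₀ (norm_ne_zero_iff.2 hra),
      Complex.ofReal_mul]
  rw [hval] at h
  simpa only [Function.comp_def, map_sum, map_smul, hterm] using h
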